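/- All graphs are finite and nonempty, have no loops, and may have multiple edges; $d_H(v)$ denotes the number of edges of $H$ incident to $v$ (parallel edges counted separately). For a graph $G$ and $S\subseteq V(G)$, let $\omega(G\setminus S)$ be the number of connected components of the graph obtained from $G$ by deleting the vertices of $S$ (so it is $0$ if $S=V(G)$). $G$ is called $2$-tree-connected if it has two edge-disjoint spanning trees, and, for a real $t>0$, $t$-tough if $\omega(G\setminus S)\le\max\{1,\tfrac1t|S|\}$ for all $S\subseteq V(G)$. A $\{2,4\}$-factor of $G$ is a spanning subgraph $H$ of $G$ with $d_H(v)\in\{2,4\}$ for every vertex $v$. A graph is Eulerian if it is connected and all its degrees are even. Theorem. Let $G$ be a $2$-tree-connected graph of order at least two. If $$\omega(G\setminus S)\le \frac27|S|+\frac97\qquad\text{for all } S\subseteq V(G),$$ then $G$ has a connected $\{2,4\}$-factor. Corollary. Every $(3+\tfrac12)$-tough graph of order at least three has a connected $\{2,4\}$-factor, that is, a spanning Eulerian subgraph whose degrees all lie in $\{2,4\}$. -/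

import Mathlib

namespace Graph

/-- A multigraph is connected if it has a vertex and any two of its vertices are joined by a walk.
Parallel edges play no role here, so this is read off the underlying simple graph on `V(G)`. -/
def IsConnected {α β : Type*} (G : Graph α β) : Prop :=
  G.toSimpleGraph.Connected

/-- `ω(G)`, the number of connected components (it is `0` for the graph without vertices). -/
noncomputable def numComponents {α β : Type*} (G : Graph α β) : ℕ :=
  Nat.card G.toSimpleGraph.ConnectedComponent

/-- The degree of `v`: the number of edges incident to `v`, parallel edges being counted
separately. It is meant for graphs without loops. -/
noncomputable def degree {α β : Type*} (G : Graph α β) (v : α) : ℕ :=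
  (G.incidenceSet v).ncard

/-- A multigraph is a tree if it is connected and has no cycle. A pair of parallel edges
is a cycle of length two and a loop is a cycle of length one, so a tree is a simple graph. -/
def IsTree {α β : Type*} (T : Graph α β) : Prop :=
  T.Simple ∧ T.toSimpleGraph.IsTree

/-- `G` is `m`-tree-connected: it has `m` pairwise edge-disjoint spanning trees. -/
def IsTreeConnected {α β : Type*} (G : Graph α β) (m : ℕ) : Prop :=
  ∃ T : Fin m → Graph α β, (∀ i, T i ≤s G ∧ (T i).IsTree) ∧
    ∀ i j, i ≠ j → Disjoint (T i).edgeSet (T j).edgeSet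

/-- `G` is `t`-tough: `ω(G ∖ S) ≤ max {1, |S| / t}` for every set `S` of vertices. -/
def IsTough {α β : Type*} (G : Graph α β) (t : ℝ) : Prop :=
  ∀ S : Set α, S ⊆ G.vertexSet →
    ((G.deleteVerts S).numComponents : ℝ) ≤ max 1 (1 / t * (S.ncard : ℝ))

/-- `H` is an `A`-factor of `G`: a spanning subgraph of `G` all of whose degrees lie in `A`. -/
def IsFactor {α β : Type*} (H G : Graph α β) (A : Set ℕ) : Prop :=
  H ≤s G ∧ ∀ v ∈ H.vertexSet, H.degree v ∈ A

/-- A multigraph is Eulerian if it is connected and all of its degrees are even. -/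
def IsEulerian {α β : Type*} (H : Graph α β) : Prop :=
  H.IsConnected ∧ ∀ v ∈ H.vertexSet, Even (H.degree v)

end Graph

section

open Finset
open scoped Classical

namespace Multigraph

variable {α β ι : Type*} {ends : β → Sym2 α}

/-! The argument runs through the (2,2)-sparsity count. A sparse edge set that is tight on `V`
contains two disjoint connected spanning edge sets (`Tight.exists_connects`). Adding to the first a
part of the second that corrects parities gives a connected spanning subgraph with even degrees
(`Tight.exists_connects_even`). If all degrees of the sparse set are at most 5, these even, positive
degrees are 2 or 4. So it suffices to find a sparse set `H` in the graph, tight on `V`, with maximum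
degree at most 5.

Choose `H` minimising the total excess of degrees over 5. If excess remains, edge exchanges inside
minimal tight sets show (`exists_deg_le_five_or_obstruction`) that there is a set `S` of vertices of
degree at least 5, one of them at least 6, such that every edge outside `H` that avoids `S` is
spanned by a tight set avoiding `S`. Let `V \ S` have p maximal tight subsets. They partition it,
and all edges between them, say q, belong to `H`. Counting the edges of `H` gives 4p - 2q ≥ 2|S| +
10.

Conversely, `splits_of_partition` deletes a further set `W` so that k mutually unjoined classes
remain with 7k ≥ 2|W| + 4p - 2q. Deleting `S ∪ W` then violates 7ω ≤ 2|S ∪ W| + 9.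

For the corollary, toughness forces every edge cut to have at least min(4, |V| - 1) edges. From
order four on this gives the Nash-Williams–Tutte partition condition, hence a suitable `H`, and the
component bound follows from toughness. A graph of order three contains a triangle. -/

/-- The edges of `F` with both ends in `X`. -/
noncomputable def inside (ends : β → Sym2 α) (F : Finset β) (X : Finset α) : Finset β :=
  F.filter fun e => ∀ x ∈ ends e, x ∈ X

/-- The degree of `v` in the multigraph with edge set `F`. -/
noncomputable def deg (ends : β → Sym2 α) (F : Finset β) (v : α) : ℕ :=
  #(F.filter fun e => v ∈ ends e)

/-- Every nonempty vertex set `X` spans at most `2 (|X| - 1)` edges of `F`. -/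
def Sparse (ends : β → Sym2 α) (F : Finset β) : Prop :=
  ∀ X : Finset α, X.Nonempty → #(inside ends F X) + 2 ≤ 2 * #X

/-- The nonempty vertex set `X` spans exactly `2 (|X| - 1)` edges of `F`. -/
def Tight (ends : β → Sym2 α) (F : Finset β) (X : Finset α) : Prop :=
  X.Nonempty ∧ #(inside ends F X) + 2 = 2 * #X

/-- Every cut of the vertex set `V` is crossed by an edge of `F`. -/
def Connects (ends : β → Sym2 α) (F : Finset β) (V : Finset α) : Prop :=
  ∀ A : Finset α, (∃ x ∈ V, x ∈ A) → (∃ y ∈ V, y ∉ A) →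
    ∃ e ∈ F, ∃ x y, ends e = s(x, y) ∧ x ∈ A ∧ y ∉ A

/-! ### Uncrossing tight sets and exchanging edges -/

theorem mem_inside {F : Finset β} {X : Finset α} {e : β} :
    e ∈ inside ends F X ↔ e ∈ F ∧ ∀ x ∈ ends e, x ∈ X := by
  simp [inside]

theorem inside_subset {F : Finset β} {X : Finset α} : inside ends F X ⊆ F :=
  filter_subset _ _

theorem inside_mono {F F' : Finset β} {X X' : Finset α} (hF : F ⊆ F') (hX : X ⊆ X') :
    inside ends F X ⊆ inside ends F' X' := by
  intro e he
  rw [mem_inside] at he ⊢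
  exact ⟨hF he.1, fun x hx => hX (he.2 x hx)⟩

theorem inside_eq_self {F : Finset β} {X : Finset α} (h : ∀ e ∈ F, ∀ x ∈ ends e, x ∈ X) :
    inside ends F X = F :=
  filter_true_of_mem h

theorem inside_inter {F : Finset β} {X Y : Finset α} :
    inside ends F (X ∩ Y) = inside ends F X ∩ inside ends F Y := by
  ext e
  simp only [mem_inside, mem_inter]
  grind

theorem card_inside_add_le (F : Finset β) (X Y : Finset α) :
    #(inside ends F X) + #(inside ends F Y) ≤
      #(inside ends F (X ∪ Y)) + #(inside ends F (X ∩ Y)) := by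
  rw [inside_inter, ← card_union_add_card_inter]
  gcongr
  exact union_subset (inside_mono subset_rfl subset_union_left)
    (inside_mono subset_rfl subset_union_right)

theorem Sparse.mono {F F' : Finset β} (h : Sparse ends F') (hF : F ⊆ F') : Sparse ends F :=
  fun X hX => (Nat.add_le_add_right (card_le_card (inside_mono hF subset_rfl)) 2).trans (h X hX)

theorem Sparse.not_isDiag {F : Finset β} (h : Sparse ends F) {e : β} (he : e ∈ F) :
    ¬ (ends e).IsDiag := by
  intro hd
  obtain ⟨x, hx⟩ : ∃ x, ends e = s(x, x) := by
    induction hz : ends e with | _ a b => rw [hz] at hd; exact ⟨a, by rw [Sym2.mk_isDiag_iff.1 hd]⟩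
  have h1 := h {x} (singleton_nonempty x)
  have h2 : 0 < #(inside ends F {x}) := card_pos.2 ⟨e, mem_inside.2 ⟨he, by simp [hx]⟩⟩
  rw [card_singleton] at h1
  omega

/-- The number of spanned edges is supermodular and the number of vertices is modular, so for two
tight sets that meet, the union and the intersection both attain the sparsity bound. -/
theorem Tight.union {F : Finset β} {X Y : Finset α} (h : Sparse ends F) (hX : Tight ends F X)
    (hY : Tight ends F Y) (hXY : (X ∩ Y).Nonempty) : Tight ends F (X ∪ Y) := by
  refine ⟨hX.1.mono subset_union_left, ?_⟩
  have h1 := h _ hXY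
  have h2 := h (X ∪ Y) (hX.1.mono subset_union_left)
  have h3 := card_inside_add_le (ends := ends) F X Y
  have h4 := card_union_add_card_inter X Y
  have h5 := hX.2
  have h6 := hY.2
  omega

theorem Tight.inter {F : Finset β} {X Y : Finset α} (h : Sparse ends F) (hX : Tight ends F X)
    (hY : Tight ends F Y) (hXY : (X ∩ Y).Nonempty) : Tight ends F (X ∩ Y) := by
  refine ⟨hXY, ?_⟩
  have h1 := h _ hXY
  have h2 := h (X ∪ Y) (hX.1.mono subset_union_left)
  have h3 := card_inside_add_le (ends := ends) F X Y
  have h4 := card_union_add_card_inter X Y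
  have h5 := hX.2
  have h6 := hY.2
  omega

theorem Sparse.tight_singleton {F : Finset β} (h : Sparse ends F) (v : α) :
    Tight ends F {v} := by
  refine ⟨singleton_nonempty v, ?_⟩
  have := h {v} (singleton_nonempty v)
  simp at this ⊢
  simpa using this

theorem Tight.congr {F F' : Finset β} {X : Finset α} (h : Tight ends F X)
    (h' : inside ends F' X = inside ends F X) : Tight ends F' X :=
  ⟨h.1, by rw [h']; exact h.2⟩

/-- Otherwise `X.erase z`, nonempty because of `w`, would still span 2(|X| - 1) edges, more than
sparsity allows. -/
theorem Tight.exists_mem_ends {F : Finset β} (h : Sparse ends F) {X : Finset α}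
    (hX : Tight ends F X) {z w : α} (hz : z ∈ X) (hw : w ∈ X) (hzw : w ≠ z) :
    ∃ f ∈ inside ends F X, z ∈ ends f := by
  by_contra! hc
  have h1 : inside ends F X ⊆ inside ends F (X.erase z) := by
    intro f hf
    have hf' := mem_inside.1 hf
    refine mem_inside.2 ⟨hf'.1, fun x hx => mem_erase.2 ⟨?_, hf'.2 x hx⟩⟩
    rintro rfl
    exact hc f hf hx
  have h2 := h (X.erase z) ⟨w, mem_erase.2 ⟨hzw, hw⟩⟩
  have h3 := card_le_card h1
  have h4 := card_erase_add_one hz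
  have h5 := hX.2
  omega

theorem Sparse.exists_tight_of_not_insert {F : Finset β} (h : Sparse ends F) {e : β}
    (hn : ¬ Sparse ends (insert e F)) :
    ∃ X, Tight ends F X ∧ ∀ x ∈ ends e, x ∈ X := by
  simp only [Sparse, not_forall] at hn
  obtain ⟨X, hX, hlt⟩ := hn
  have h1 := h X hX
  by_cases hi : ∀ x ∈ ends e, x ∈ X
  · refine ⟨X, ⟨hX, ?_⟩, hi⟩
    have h2 : inside ends (insert e F) X ⊆ insert e (inside ends F X) := by
      intro f hf
      simp only [mem_inside, mem_insert] at hf ⊢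
      tauto
    have h3 := (card_le_card h2).trans (card_insert_le _ _)
    omega
  · have h2 : inside ends (insert e F) X ⊆ inside ends F X := by
      intro f hf
      simp only [mem_inside, mem_insert] at hf ⊢
      rcases hf with ⟨rfl | hf, h'⟩
      · exact absurd h' hi
      · exact ⟨hf, h'⟩
    have := card_le_card h2
    omega

theorem Sparse.exists_minimal_tight {F : Finset β} (h : Sparse ends F) {x y : α} {X : Finset α}
    (hX : Tight ends F X) (hx : x ∈ X) (hy : y ∈ X) :
    ∃ X₀, Tight ends F X₀ ∧ x ∈ X₀ ∧ y ∈ X₀ ∧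
      ∀ Y, Tight ends F Y → x ∈ Y → y ∈ Y → X₀ ⊆ Y := by
  obtain ⟨X₀, hX₀, hmin⟩ := exists_min_image
    (X.powerset.filter fun Y => Tight ends F Y ∧ x ∈ Y ∧ y ∈ Y) card
    ⟨X, by simp [hX, hx, hy]⟩
  simp only [mem_filter, mem_powerset] at hX₀ hmin
  refine ⟨X₀, hX₀.2.1, hX₀.2.2.1, hX₀.2.2.2, fun Y hY hxY hyY => ?_⟩
  have hx' : x ∈ X₀ ∩ Y := mem_inter.2 ⟨hX₀.2.2.1, hxY⟩
  have := hmin (X₀ ∩ Y) ⟨inter_subset_left.trans hX₀.1, hX₀.2.1.inter h hY ⟨x, hx'⟩, hx',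
    mem_inter.2 ⟨hX₀.2.2.2, hyY⟩⟩
  rw [← eq_of_subset_of_card_le inter_subset_left this]
  exact inter_subset_right

/-- A violation would come from a set tight for `F.erase f` containing both ends of `e`. It is then
tight for `F`, so it contains `X₀` and therefore spans `f`, whose removal must lower its count. When
`e` is not in `F`, the edges inside `X₀` together with `e` form the fundamental circuit of `e` in
the sparsity matroid. -/
theorem Sparse.exchange {F : Finset β} (h : Sparse ends F) {e f : β} {x y : α}
    (he : ends e = s(x, y))
    {X₀ : Finset α} (hmin : ∀ Y, Tight ends F Y → x ∈ Y → y ∈ Y → X₀ ⊆ Y)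
    (hf : f ∈ inside ends F X₀) : Sparse ends (insert e (F.erase f)) := by
  by_contra hn
  obtain ⟨X, hX, hi⟩ := (h.mono (erase_subset f F)).exists_tight_of_not_insert hn
  rw [he] at hi
  have h1 : #(inside ends (F.erase f) X) ≤ #(inside ends F X) :=
    card_le_card (inside_mono (erase_subset _ _) subset_rfl)
  have h2 := h X hX.1
  have hXF : Tight ends F X := ⟨hX.1, by have := hX.2; omega⟩
  have hsub := hmin X hXF (hi x (by simp)) (hi y (by simp))
  have hfX : f ∈ inside ends F X := inside_mono subset_rfl hsub hf
  have h3 : #(inside ends (F.erase f) X) < #(inside ends F X) := by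
    refine card_lt_card (ssubset_iff_of_subset (inside_mono (erase_subset _ _) subset_rfl) |>.2
      ⟨f, hfX, ?_⟩)
    simp [mem_inside]
  have := hX.2
  have := hXF.2
  omega

/-! ### Replacement inside a tight set, and degree counting -/

/-- The edge set which agrees with `G` inside `C` and with `F` elsewhere. -/
noncomputable def replace (ends : β → Sym2 α) (F G : Finset β) (C : Finset α) : Finset β :=
  (F \ inside ends F C) ∪ inside ends G C

theorem mem_replace {F G : Finset β} {C : Finset α} {e : β} :
    e ∈ replace ends F G C ↔
      (e ∈ F ∧ ¬ ∀ x ∈ ends e, x ∈ C) ∨ (e ∈ G ∧ ∀ x ∈ ends e, x ∈ C) := by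
  simp only [replace, mem_union, mem_sdiff, mem_inside]
  tauto

theorem inside_replace_of_subset {F G : Finset β} {C X : Finset α} (h : X ⊆ C) :
    inside ends (replace ends F G C) X = inside ends G X := by
  ext e
  simp only [mem_inside, mem_replace]
  grind

theorem card_inside_replace {F G : Finset β} {C X : Finset α} :
    #(inside ends (replace ends F G C) X) + #(inside ends F (X ∩ C)) =
      #(inside ends F X) + #(inside ends G (X ∩ C)) := by
  have h1 : inside ends (replace ends F G C) X =
      (inside ends F X \ inside ends F (X ∩ C)) ∪ inside ends G (X ∩ C) := by
    ext e
    simp only [mem_inside, mem_replace, mem_union, mem_sdiff, mem_inter]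
    grind
  have h2 : Disjoint (inside ends F X \ inside ends F (X ∩ C)) (inside ends G (X ∩ C)) := by
    rw [disjoint_left]
    intro e
    simp only [mem_inside, mem_sdiff, mem_inter]
    grind
  have h3 : inside ends F (X ∩ C) ⊆ inside ends F X := inside_mono subset_rfl inter_subset_left
  rw [h1, card_union_of_disjoint h2, card_sdiff_of_subset h3]
  have := card_le_card h3
  omega

/-- When `X` meets `C`, uncrossing them bounds the edges of `F` inside `X` but not inside `X ∩ C` by
2|X| - 2|X ∩ C|. This leaves just enough room for the edges of a sparse `G` inside `X ∩ C`. -/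
theorem Sparse.replace {F G : Finset β} {C : Finset α} (hF : Sparse ends F) (hG : Sparse ends G)
    (hFC : Tight ends F C) : Sparse ends (replace ends F G C) := by
  intro X hX
  have h1 := card_inside_replace (ends := ends) (F := F) (G := G) (C := C) (X := X)
  rcases (X ∩ C).eq_empty_or_nonempty with he | hne
  · have h2 : #(inside ends G (X ∩ C)) ≤ #(inside ends F (X ∩ C)) := by
      rw [he]
      have : inside ends G ∅ = ∅ := by
        ext e
        simp only [mem_inside, notMem_empty, iff_false, not_and]
        intro _ h
        induction hz : ends e with | _ a b => exact h a (by simp [hz])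
      simp [this]
    have := hF X hX
    omega
  · have h2 := hG _ hne
    have h3 := hF (X ∪ C) (hX.mono subset_union_left)
    have h4 := card_inside_add_le (ends := ends) F X C
    have h5 := card_union_add_card_inter X C
    have h6 := hFC.2
    omega

/-- An edge with j ends in `S` contributes max(1, j) to both sides. -/
theorem sum_deg_add_card_inside {F : Finset β} {V S : Finset α}
    (hF : ∀ e ∈ F, ∀ x ∈ ends e, x ∈ V) (hl : ∀ e ∈ F, ¬ (ends e).IsDiag) :
    ∑ v ∈ S, deg ends F v + #(inside ends F (V \ S)) = #F + #(inside ends F S) := by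
  have h1 : ∑ v ∈ S, deg ends F v = ∑ e ∈ F, #(S.filter fun v => v ∈ ends e) :=
    sum_card_bipartiteAbove_eq_sum_card_bipartiteBelow (fun v e => v ∈ ends e)
  rw [h1, inside, inside, card_filter, card_filter, card_eq_sum_ones F, ← sum_add_distrib,
    ← sum_add_distrib]
  refine sum_congr rfl fun e he => ?_
  have hV := hF e he
  have hd := hl e he
  induction hz : ends e with | _ a b =>
  rw [hz] at hV hd
  rw [Sym2.mk_isDiag_iff] at hd
  simp only [Sym2.mem_iff, forall_eq_or_imp, forall_eq, mem_sdiff] at hV ⊢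
  have h2 : S.filter (fun v => v = a ∨ v = b) = S ∩ {a, b} := by
    ext; simp
  rw [h2]
  by_cases ha : a ∈ S <;> by_cases hb : b ∈ S <;> simp [ha, hb, hV]
  · exact card_pair hd

/-! ### Two disjoint connected spanning edge sets -/

theorem inside_congr {ends' : β → Sym2 α} {F : Finset β} (h : ∀ e ∈ F, ends' e = ends e)
    (X : Finset α) : inside ends' F X = inside ends F X := by
  ext e
  simp only [mem_inside]
  exact and_congr_right fun he => by rw [h e he]

theorem Connects.congr {ends' : β → Sym2 α} {T : Finset β} {V : Finset α}
    (h : Connects ends' T V) (he : ∀ e ∈ T, ends' e = ends e) : Connects ends T V := by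
  intro A hx hy
  obtain ⟨e, heT, x, y, hxy, h1⟩ := h A hx hy
  exact ⟨e, heT, x, y, (he e heT) ▸ hxy, h1⟩

theorem Connects.mono {T T' : Finset β} {V : Finset α} (h : Connects ends T V) (hT : T ⊆ T') :
    Connects ends T' V := by
  intro A hx hy
  obtain ⟨e, heT, h1⟩ := h A hx hy
  exact ⟨e, hT heT, h1⟩

theorem Connects.insert_pendant {T : Finset β} {V : Finset α} {v a : α} {e : β}
    (h : Connects ends T (V.erase v)) (he : ends e = s(v, a)) (ha : a ∈ V) (hav : a ≠ v) :
    Connects ends (insert e T) V := by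
  rintro A ⟨x, hxV, hx⟩ ⟨y, hyV, hy⟩
  by_cases haA : a ∈ A <;> by_cases hvA : v ∈ A
  · obtain ⟨f, hf, h1⟩ := h A ⟨a, by simp [ha, hav], haA⟩ ⟨y, by simp; grind, hy⟩
    exact ⟨f, mem_insert_of_mem hf, h1⟩
  · exact ⟨e, mem_insert_self _ _, a, v, by rw [he, Sym2.eq_swap], haA, hvA⟩
  · exact ⟨e, mem_insert_self _ _, v, a, he, hvA, haA⟩
  · obtain ⟨f, hf, h1⟩ := h A ⟨x, by simp; grind, hx⟩ ⟨a, by simp [ha, hav], haA⟩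
    exact ⟨f, mem_insert_of_mem hf, h1⟩

/-- The label `e` first stands for an edge `ab` split off at `v`; putting the path `a v b` back in
its place reaches `v` and keeps `a` and `b` joined. -/
theorem Connects.subdivide {T : Finset β} {V : Finset α} {v a b : α} {e f : β}
    (h : Connects (Function.update ends e s(a, b)) T (V.erase v)) (he : ends e = s(v, a))
    (hf : ends f = s(v, b)) (ha : a ∈ V) (hav : a ≠ v) (heT : e ∈ T) :
    Connects ends (insert f T) V := by
  rintro A ⟨x, hxV, hx⟩ ⟨y, hyV, hy⟩
  have key : (a ∈ A ↔ b ∈ A) → (∃ x ∈ V.erase v, x ∈ A) → (∃ y ∈ V.erase v, y ∉ A) →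
      ∃ g ∈ insert f T, ∃ x y, ends g = s(x, y) ∧ x ∈ A ∧ y ∉ A := by
    intro hab hx hy
    obtain ⟨g, hg, p, q, hpq, hp, hq⟩ := h A hx hy
    have hne : g ≠ e := by
      rintro rfl
      rw [Function.update_self, Sym2.eq_iff] at hpq
      grind
    rw [Function.update_of_ne hne] at hpq
    exact ⟨g, mem_insert_of_mem hg, p, q, hpq, hp, hq⟩
  by_cases haA : a ∈ A <;> by_cases hvA : v ∈ A
  · by_cases hbA : b ∈ A
    · exact key (by tauto) ⟨a, by simp [ha, hav], haA⟩ ⟨y, by simp; grind, hy⟩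
    · exact ⟨f, mem_insert_self _ _, v, b, hf, hvA, hbA⟩
  · exact ⟨e, mem_insert_of_mem heT, a, v, by rw [he, Sym2.eq_swap], haA, hvA⟩
  · exact ⟨e, mem_insert_of_mem heT, v, a, he, hvA, haA⟩
  · by_cases hbA : b ∈ A
    · exact ⟨f, mem_insert_self _ _, b, v, by rw [hf, Sym2.eq_swap], hbA, hvA⟩
    · exact key (by tauto) ⟨x, by simp; grind, hx⟩ ⟨a, by simp [ha, hav], haA⟩

/-- The two tight sets would share `b`, so their union would be tight. Adding `v` to it adds three
edges, while one more vertex allows only two. -/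
theorem Sparse.exists_split {H : Finset β} (h : Sparse ends H) {v a b c : α} {e f g : β}
    (he : ends e = s(v, a)) (hf : ends f = s(v, b)) (hg : ends g = s(v, c))
    (hef : e ≠ f) (heg : e ≠ g) (hfg : f ≠ g) (heH : e ∈ H) (hfH : f ∈ H) (hgH : g ∈ H)
    {H₀ : Finset β} (hH₀ : H₀ ⊆ H) (hv : ∀ e ∈ H₀, v ∉ ends e)
    (hab : ∃ X, Tight ends H₀ X ∧ a ∈ X ∧ b ∈ X) : ¬ ∃ X, Tight ends H₀ X ∧ b ∈ X ∧ c ∈ X := by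
  rintro ⟨Y, hY, hbY, hcY⟩
  obtain ⟨X, hX, haX, hbX⟩ := hab
  have hZ := hX.union (h.mono hH₀) hY ⟨b, mem_inter.2 ⟨hbX, hbY⟩⟩
  set Z := X ∪ Y
  have haZ : a ∈ Z := mem_union_left _ haX
  have hbZ : b ∈ Z := mem_union_left _ hbX
  have hcZ : c ∈ Z := mem_union_right _ hcY
  have h1 : ({e, f, g} : Finset β) ∪ inside ends H₀ Z ⊆ inside ends H (insert v Z) := by
    refine union_subset ?_ (inside_mono hH₀ (subset_insert _ _))
    intro x hx
    simp only [mem_insert, mem_singleton] at hx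
    rcases hx with rfl | rfl | rfl <;> simp [mem_inside, *]
  have h2 : Disjoint ({e, f, g} : Finset β) (inside ends H₀ Z) := by
    rw [disjoint_left]
    intro x hx hx'
    have := hv x (mem_inside.1 hx').1
    simp only [mem_insert, mem_singleton] at hx
    rcases hx with rfl | rfl | rfl <;> simp [*] at this
  have h3 := card_le_card h1
  rw [card_union_of_disjoint h2, card_eq_three.2 ⟨e, f, g, hef, heg, hfg, rfl⟩] at h3
  have h4 := h (insert v Z) (insert_nonempty _ _)
  have h5 := card_insert_le v Z
  have h6 := hZ.2
  omega

/-- The case `m = 2` of the Nash-Williams theorem for a multigraph with `2 (|V| - 1)` edges. -/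
theorem Tight.exists_connects {V : Finset α} : ∀ {ends : β → Sym2 α} {H : Finset β},
    Sparse ends H → Tight ends H V → (∀ e ∈ H, ∀ x ∈ ends e, x ∈ V) →
    ∃ T₁ T₂, T₁ ⊆ H ∧ T₂ ⊆ H ∧ Disjoint T₁ T₂ ∧ Connects ends T₁ V ∧ Connects ends T₂ V := by
  induction V using Finset.strongInduction with | _ V ih =>
  intro ends H hH hV hHV
  rcases Nat.lt_or_ge #V 2 with hc | hc
  · have : ∀ x ∈ V, ∀ y ∈ V, x = y := card_le_one.1 (by omega)
    have h0 : Connects ends (∅ : Finset β) V := by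
      rintro A ⟨x, hx, hxA⟩ ⟨y, hy, hyA⟩
      exact absurd (this x hx y hy ▸ hxA) hyA
    exact ⟨∅, ∅, by simp, by simp, by simp, h0, h0⟩
  have hl : ∀ e ∈ H, ¬ (ends e).IsDiag := fun e he => hH.not_isDiag he
  -- The degrees sum to 4|V| - 4. The lower bound 2 for this degree comes below from sparsity on
  -- `V.erase v`.
  obtain ⟨v, hvV, hv⟩ : ∃ v ∈ V, deg ends H v ≤ 3 := by
    by_contra! hcon
    have h1 := sum_deg_add_card_inside (S := V) hHV hl
    have h2 := card_nsmul_le_sum V (fun v => deg ends H v) 4 fun v hv => hcon v hv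
    have h3 := hV.2
    have h4 : #(inside ends H V) = #H := by rw [inside_eq_self hHV]
    simp only [smul_eq_mul] at h2
    omega
  set D := H.filter fun e => v ∈ ends e with hD
  set H₀ := H.filter fun e => v ∉ ends e with hH₀
  have hDH : #D + #H₀ = #H := card_filter_add_card_filter_not _
  have hDc : #D = deg ends H v := rfl
  have hH₀s : H₀ ⊆ H := filter_subset _ _
  have hH₀V : ∀ e ∈ H₀, ∀ x ∈ ends e, x ∈ V.erase v := by
    intro e he x hx
    rw [hH₀, mem_filter] at he
    exact mem_erase.2 ⟨fun h => he.2 (h ▸ hx), hHV e he.1 x hx⟩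
  have hlt : V.erase v ⊂ V := erase_ssubset hvV
  have hcard := card_erase_add_one hvV
  have hne : (V.erase v).Nonempty := card_pos.1 (by omega)
  have hVc := hV.2
  rw [inside_eq_self hHV] at hVc
  have hsp : Sparse ends H₀ := hH.mono hH₀s
  have hins := hsp _ hne
  rw [inside_eq_self hH₀V] at hins
  have hother : ∀ e ∈ D, ∃ a ∈ V, a ≠ v ∧ ends e = s(v, a) := by
    intro e he
    rw [hD, mem_filter] at he
    obtain ⟨a, ha⟩ := he.2
    refine ⟨a, hHV e he.1 a (by simp [ha]), ?_, ha⟩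
    rintro rfl
    exact hl e he.1 (by simp [ha])
  have hDsub : ∀ e ∈ D, e ∈ H ∧ e ∉ H₀ := by
    intro e he
    simp only [hD, hH₀, mem_filter] at he ⊢
    tauto
  rcases (show #D = 2 ∨ #D = 3 by omega) with h2 | h3
  · obtain ⟨e, f, hef, hDef⟩ := card_eq_two.1 h2
    have heD : e ∈ D := by simp [hDef]
    have hfD : f ∈ D := by simp [hDef]
    obtain ⟨a, haV, hav, ha⟩ := hother e heD
    obtain ⟨b, hbV, hbv, hb⟩ := hother f hfD
    obtain ⟨T₁, T₂, h1, h2, hd, hc1, hc2⟩ := ih _ hlt hsp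
      ⟨hne, by rw [inside_eq_self hH₀V]; omega⟩ hH₀V
    have hTe : ∀ e ∈ D, e ∉ T₁ ∧ e ∉ T₂ := fun e he =>
      ⟨fun h => (hDsub e he).2 (h1 h), fun h => (hDsub e he).2 (h2 h)⟩
    refine ⟨insert e T₁, insert f T₂, insert_subset (hDsub e heD).1 (h1.trans hH₀s),
      insert_subset (hDsub f hfD).1 (h2.trans hH₀s), ?_, hc1.insert_pendant ha haV hav,
      hc2.insert_pendant hb hbV hbv⟩
    rw [disjoint_insert_left, disjoint_insert_right, mem_insert, not_or]
    exact ⟨⟨hef, (hTe e heD).2⟩, (hTe f hfD).1, hd⟩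
  · obtain ⟨e, f, g, hef, heg, hfg, hDefg⟩ := card_eq_three.1 h3
    have heD : e ∈ D := by simp [hDefg]
    have hfD : f ∈ D := by simp [hDefg]
    have hgD : g ∈ D := by simp [hDefg]
    -- A pair of edges at `v` is needed whose far ends lie in no common tight set, so that joining
    -- these ends preserves sparsity. Singletons being tight, the far ends are then distinct.
    have hgood : ∃ e ∈ D, ∃ f ∈ D, ∃ g ∈ D, e ≠ f ∧ e ≠ g ∧ f ≠ g ∧
        ∃ a b, ends e = s(v, a) ∧ ends f = s(v, b) ∧ a ∈ V ∧ a ≠ v ∧ b ∈ V ∧ b ≠ v ∧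
        ¬ ∃ X, Tight ends H₀ X ∧ a ∈ X ∧ b ∈ X := by
      obtain ⟨a, haV, hav, ha⟩ := hother e heD
      obtain ⟨b, hbV, hbv, hb⟩ := hother f hfD
      obtain ⟨c, hcV, hcv, hc⟩ := hother g hgD
      by_cases hab : ∃ X, Tight ends H₀ X ∧ a ∈ X ∧ b ∈ X
      · exact ⟨f, hfD, g, hgD, e, heD, hfg, hef.symm, heg.symm, b, c, hb, hc, hbV, hbv, hcV, hcv,
          hH.exists_split ha hb hc hef heg hfg (hDsub e heD).1 (hDsub f hfD).1 (hDsub g hgD).1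
            hH₀s (fun e he => (mem_filter.1 he).2) hab⟩
      · exact ⟨e, heD, f, hfD, g, hgD, hef, heg, hfg, a, b, ha, hb, haV, hav, hbV, hbv, hab⟩
    clear! e f g
    obtain ⟨e, heD, f, hfD, g, hgD, hef, heg, hfg, a, b, ha, hb, haV, hav, hbV, hbv, hab⟩ := hgood
    obtain ⟨c, hcV, hcv, hc⟩ := hother g hgD
    -- The split-off edge reuses the label `e`, so the induction hypothesis is applied to a changed
    -- incidence map instead of a larger edge type.
    set ends' := Function.update ends e s(a, b) with hends'
    have heH₀ := (hDsub e heD).2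
    have hends : ∀ x ∈ H₀, ends' x = ends x := fun x hx =>
      Function.update_of_ne (ne_of_mem_of_not_mem hx heH₀) _ _
    have hsp' : Sparse ends' H₀ := fun X hX => by
      rw [inside_congr hends]; exact hsp X hX
    have hends'e : ends' e = s(a, b) := Function.update_self _ _ _
    have hsp1 : Sparse ends' (insert e H₀) := by
      by_contra hn
      obtain ⟨X, hX, hi⟩ := hsp'.exists_tight_of_not_insert hn
      rw [hends'e] at hi
      refine hab ⟨X, ⟨hX.1, ?_⟩, hi a (by simp), hi b (by simp)⟩
      rw [← inside_congr hends]
      exact hX.2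
    have hV1 : ∀ x ∈ insert e H₀, ∀ y ∈ ends' x, y ∈ V.erase v := by
      intro x hx y hy
      rcases mem_insert.1 hx with rfl | hx
      · rw [hends'e] at hy
        rcases Sym2.mem_iff.1 hy with rfl | rfl <;> simp [*]
      · exact hH₀V x hx y (hends x hx ▸ hy)
    have hcons := ih _ hlt hsp1 ⟨hne, by
      rw [inside_eq_self hV1, card_insert_of_notMem heH₀]; omega⟩ hV1
    have hwlog : ∃ T₁ T₂, T₁ ⊆ insert e H₀ ∧ T₂ ⊆ insert e H₀ ∧ Disjoint T₁ T₂ ∧ e ∉ T₂ ∧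
        Connects ends' T₁ (V.erase v) ∧ Connects ends' T₂ (V.erase v) := by
      obtain ⟨T₁, T₂, h1, h2, hd, hc1, hc2⟩ := hcons
      by_cases he : e ∈ T₂
      · exact ⟨T₂, T₁, h2, h1, hd.symm, disjoint_right.1 hd he, hc2, hc1⟩
      · exact ⟨T₁, T₂, h1, h2, hd, he, hc1, hc2⟩
    obtain ⟨T₁, T₂, h1, h2, hd, heT, hc1, hc2⟩ := hwlog
    have h2' : T₂ ⊆ H₀ := (subset_insert_iff_of_notMem heT).1 h2
    have hnot : ∀ x ∈ D, x ≠ e → x ∉ T₁ ∧ x ∉ T₂ := fun x hx hxe =>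
      ⟨fun h => by
        rcases mem_insert.1 (h1 h) with h | h
        exacts [hxe h, (hDsub x hx).2 h], fun h => (hDsub x hx).2 (h2' h)⟩
    refine ⟨insert e (insert f T₁), insert g T₂, ?_, insert_subset (hDsub g hgD).1 (h2'.trans hH₀s),
      ?_, ?_, ?_⟩
    · refine insert_subset (hDsub e heD).1 (insert_subset (hDsub f hfD).1 (h1.trans ?_))
      exact insert_subset (hDsub e heD).1 hH₀s
    · have := hnot f hfD hef.symm
      have := hnot g hgD heg.symm
      simp only [disjoint_insert_left, disjoint_insert_right, mem_insert, not_or]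
      tauto
    · by_cases heT₁ : e ∈ T₁
      · exact (hc1.subdivide ha hb haV hav heT₁).mono (subset_insert _ _)
      · have : Connects ends T₁ (V.erase v) := hc1.congr fun x hx =>
          Function.update_of_ne (ne_of_mem_of_not_mem hx heT₁) _ _
        exact (this.insert_pendant ha haV hav).mono (insert_subset_insert _ (subset_insert _ _))
    · have : Connects ends T₂ (V.erase v) := hc2.congr fun x hx =>
          Function.update_of_ne (ne_of_mem_of_not_mem hx heT) _ _
      exact this.insert_pendant hc hcV hcv

/-! ### Parity correction and connected even subgraphs -/

/-- This `χ` plays the role of a path from `x` to `y` modulo 2. The set of possible `y` contains `x`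
and no edge of `T` leaves it, since toggling an edge moves the endpoint across it. -/
theorem Connects.exists_boundary_eq_pair {T : Finset β} {V : Finset α} (hT : Connects ends T V)
    (hTV : ∀ e ∈ T, ∀ x ∈ ends e, x ∈ V) {x y : α} (hx : x ∈ V) (hy : y ∈ V) :
    ∃ χ : β → ZMod 2, ∀ v, ∑ e ∈ T, (if v ∈ ends e then χ e else 0) =
      (if v = x then 1 else 0) + (if v = y then 1 else 0) := by
  have htwo : ∀ a : ZMod 2, a + a = 0 := by decide
  set P : α → Prop := fun y => ∃ χ : β → ZMod 2, ∀ v,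
    ∑ e ∈ T, (if v ∈ ends e then χ e else 0) = (if v = x then 1 else 0) + (if v = y then 1 else 0)
  have hPx : P x := ⟨0, fun v => by rw [htwo]; simp⟩
  by_contra hn
  obtain ⟨e, heT, p, q, he, hp, hq⟩ := hT (V.filter P) ⟨x, hx, by simp [hx, hPx]⟩
    ⟨y, hy, fun h => hn (mem_filter.1 h).2⟩
  have hqV : q ∈ V := hTV e heT q (by simp [he])
  have hpq : p ≠ q := by rintro rfl; exact hq hp
  obtain ⟨χ, hχ⟩ := (mem_filter.1 hp).2
  refine hq (mem_filter.2 ⟨hqV, χ + Pi.single e 1, fun v => ?_⟩)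
  have h1 : ∀ f, (if v ∈ ends f then (χ + (Pi.single e 1 : β → ZMod 2)) f else 0) =
      (if v ∈ ends f then χ f else 0) + (if f = e then (if v ∈ ends e then 1 else 0) else 0) := by
    intro f
    by_cases hf : f = e
    · subst hf; by_cases hv : v ∈ ends f <;> simp [hv]
    · by_cases hv : v ∈ ends f <;> simp [hv, hf]
  rw [sum_congr rfl fun f _ => h1 f, sum_add_distrib, hχ, sum_ite_eq' T e, if_pos heT, add_assoc]
  congr 1
  rw [he]
  simp only [Sym2.mem_iff]
  by_cases h1 : v = p
  · subst h1; simp [hpq, htwo]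
  · simp [h1]

theorem Connects.exists_even {T₁ T₂ : Finset β} {V : Finset α} (hV : V.Nonempty)
    (hT : Connects ends T₂ V) (hd : Disjoint T₁ T₂)
    (h₁ : ∀ e ∈ T₁, ∀ x ∈ ends e, x ∈ V) (h₂ : ∀ e ∈ T₂, ∀ x ∈ ends e, x ∈ V)
    (hl : ∀ e ∈ T₁, ¬ (ends e).IsDiag) :
    ∃ J, T₁ ⊆ J ∧ J ⊆ T₁ ∪ T₂ ∧ ∀ v ∈ V, Even (deg ends J v) := by
  have htwo : ∀ a : ZMod 2, a + a = 0 := by decide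
  obtain ⟨r, hr⟩ := hV
  choose! χ hχ using fun y (hy : y ∈ V) => hT.exists_boundary_eq_pair h₂ hr hy
  set f : α → ZMod 2 := fun v => deg ends T₁ v with hf
  have hsum : ∑ v ∈ V, f v = 0 := by
    have h := sum_deg_add_card_inside (S := V) h₁ hl
    rw [inside_eq_self h₁, Finset.sdiff_self, show inside ends T₁ ∅ = ∅ from ?_, card_empty,
      add_zero] at h
    · have := congrArg (Nat.cast : ℕ → ZMod 2) h
      push_cast at this
      rw [hf, this, htwo]
    · ext e
      simp only [mem_inside, notMem_empty, iff_false, not_and]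
      intro _ h
      induction hz : ends e with | _ a b => exact h a (by simp [hz])
  -- Superpose the paths from the root `r` to all vertices of odd `T₁`-degree. Their contributions
  -- at `r` cancel because the number of odd vertices is even.
  set ψ : β → ZMod 2 := fun e => ∑ y ∈ V, f y * χ y e with hψ
  have hψ' : ∀ v ∈ V, ∑ e ∈ T₂, (if v ∈ ends e then ψ e else 0) = f v := by
    intro v hv
    have h1 : ∀ e, (if v ∈ ends e then ψ e else 0) =
        ∑ y ∈ V, f y * (if v ∈ ends e then χ y e else 0) := by
      intro e
      by_cases h : v ∈ ends e <;> simp [h, hψ]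
    rw [sum_congr rfl fun e _ => h1 e, sum_comm]
    simp only [← mul_sum]
    rw [sum_congr rfl fun y hy => by rw [hχ y hy v]]
    simp only [mul_add, sum_add_distrib, ← sum_mul, hsum]
    simp [hv]
  refine ⟨T₁ ∪ T₂.filter fun e => ψ e = 1, subset_union_left,
    union_subset_union subset_rfl (filter_subset _ _), fun v hv => ?_⟩
  rw [← ZMod.natCast_eq_zero_iff_even, deg, filter_union, card_union_of_disjoint, Nat.cast_add]
  · have h3 : ((#{e ∈ T₂.filter (fun e => ψ e = 1) | v ∈ ends e} : ℕ) : ZMod 2) = f v := by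
      rw [← hψ' v hv, filter_filter, card_filter, Nat.cast_sum]
      refine sum_congr rfl fun e _ => ?_
      have : ∀ a : ZMod 2, a = 0 ∨ a = 1 := by decide
      rcases this (ψ e) with h | h <;> by_cases h' : v ∈ ends e <;> simp [h, h']
    rw [h3]
    exact htwo _
  · exact disjoint_filter_filter (hd.mono_right (filter_subset _ _))

/-- Every multigraph which is a union of two edge-disjoint spanning trees has a spanning connected
subgraph with even degrees. -/
theorem Tight.exists_connects_even {V : Finset α} {H : Finset β} (hH : Sparse ends H)
    (hV : Tight ends H V) (hHV : ∀ e ∈ H, ∀ x ∈ ends e, x ∈ V) :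
    ∃ J ⊆ H, Connects ends J V ∧ ∀ v ∈ V, Even (deg ends J v) := by
  obtain ⟨T₁, T₂, h1, h2, hd, hc1, hc2⟩ := hV.exists_connects hH hHV
  obtain ⟨J, hJ1, hJ2, hJ⟩ := hc2.exists_even hV.1 hd (fun e he => hHV e (h1 he))
    (fun e he => hHV e (h2 he)) (fun e he => hH.not_isDiag (h1 he))
  exact ⟨J, hJ2.trans (union_subset h1 h2), hc1.mono hJ1, hJ⟩

/-! ### Lowering degrees by exchanges -/

theorem deg_insert {F : Finset β} {e : β} (he : e ∉ F) (v : α) :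
    deg ends (insert e F) v = deg ends F v + if v ∈ ends e then 1 else 0 := by
  unfold deg
  rw [filter_insert]
  split_ifs with h
  · rw [card_insert_of_notMem (by simp [he])]
  · rfl

theorem deg_erase {F : Finset β} {e : β} (he : e ∈ F) (v : α) :
    deg ends (F.erase e) v + (if v ∈ ends e then 1 else 0) = deg ends F v := by
  rw [← deg_insert (notMem_erase e F), insert_erase he]

theorem deg_mono {F F' : Finset β} (h : F ⊆ F') (v : α) : deg ends F v ≤ deg ends F' v :=
  card_le_card (filter_subset_filter _ h)

theorem card_le_deg {F F' : Finset β} {v : α} (h : ∀ e ∈ F', e ∈ F ∧ v ∈ ends e) :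
    #F' ≤ deg ends F v :=
  card_le_card fun e he => mem_filter.2 (h e he)

theorem deg_congr {F F' : Finset β} {v : α} (h : ∀ e, v ∈ ends e → (e ∈ F ↔ e ∈ F')) :
    deg ends F v = deg ends F' v := by
  unfold deg
  congr 1
  ext e
  simp only [mem_filter]
  exact ⟨fun h' => ⟨(h e h'.2).1 h'.1, h'.2⟩, fun h' => ⟨(h e h'.2).2 h'.1, h'.2⟩⟩

/-- `F` and `F'` contain the same edges among those which do not lie inside `C`. -/
def AgreeOff (ends : β → Sym2 α) (F F' : Finset β) (C : Finset α) : Prop :=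
  ∀ e, (¬ ∀ x ∈ ends e, x ∈ C) → (e ∈ F' ↔ e ∈ F)

theorem AgreeOff.symm {F F' : Finset β} {C : Finset α} (h : AgreeOff ends F F' C) :
    AgreeOff ends F' F C :=
  fun e he => (h e he).symm

theorem AgreeOff.eq_replace {F F' : Finset β} {C : Finset α} (h : AgreeOff ends F F' C) :
    replace ends F F' C = F' := by
  ext e
  rw [mem_replace]
  have := h e
  tauto

theorem AgreeOff.tight {F F' : Finset β} {C X : Finset α} (h : AgreeOff ends F F' C)
    (hF : Tight ends F C) (hF' : Tight ends F' C) (hCX : C ⊆ X) (hX : Tight ends F X) :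
    Tight ends F' X := by
  refine ⟨hX.1, ?_⟩
  have h1 := card_inside_replace (ends := ends) (F := F) (G := F') (C := C) (X := X)
  rw [h.eq_replace, inter_eq_right.2 hCX] at h1
  have := hF.2
  have := hF'.2
  have := hX.2
  omega

theorem AgreeOff.deg_eq {F F' : Finset β} {C : Finset α} (h : AgreeOff ends F F' C) {v : α}
    (hv : v ∉ C) : deg ends F' v = deg ends F v :=
  deg_congr fun e he => h e fun h' => hv (h' v he)

theorem AgreeOff.inside_eq {F F' : Finset β} {C X : Finset α} (h : AgreeOff ends F F' C)
    (hX : Disjoint X C) : inside ends F' X = inside ends F X := by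
  ext e
  simp only [mem_inside]
  refine and_congr_left fun he => h e fun h' => ?_
  induction hz : ends e with | _ a b =>
    exact disjoint_left.1 hX (he a (by simp [hz])) (h' a (by simp [hz]))

/-- Inside a tight set of vertices avoiding `U`, the edge set `H` can be replaced by another one
for which the degrees in this set are at most `5`, and the degree of `v` is at most `4`. -/
def Reducible (ends : β → Sym2 α) (E H : Finset β) (V U : Finset α) (v : α) : Prop :=
  ∃ C ⊆ V \ U, v ∈ C ∧ Tight ends H C ∧ ∃ H' ⊆ E, Sparse ends H' ∧ Tight ends H' C ∧
    AgreeOff ends H H' C ∧ (∀ u ∈ C, deg ends H' u ≤ 5) ∧ deg ends H' v ≤ 4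

-- The tight sets `A` and `B` witnessing reducibility of `x` and `y` are disjoint: otherwise their
-- union would be a tight set containing both `x` and `y` but not `z`. Both replacements can
-- therefore be made at once, giving `K` in which `x` and `y` have degree at most 4 and can afford
-- the new edge `e`. Exchanging `e` for an edge at `z` then lowers the degree of `z`, which the
-- replacements have not altered.
set_option maxHeartbeats 1000000 in
theorem Reducible.exists_swap {E H : Finset β} {V U X₀ : Finset α} {x y z : α} {e : β}
    (hH : Sparse ends H) (heE : e ∈ E) (heH : e ∉ H) (he : ends e = s(x, y))
    (hx : Reducible ends E H V U x) (hy : Reducible ends E H V U y)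
    (hX₀ : Tight ends H X₀) (hxX : x ∈ X₀) (hyX : y ∈ X₀)
    (hmin : ∀ Y, Tight ends H Y → x ∈ Y → y ∈ Y → X₀ ⊆ Y) (hzX : z ∈ X₀) (hzU : z ∈ U) :
    ∃ C, Tight ends H C ∧ X₀ ⊆ C ∧ C ⊆ X₀ ∪ V \ U ∧ ∃ H' ⊆ E, Sparse ends H' ∧ Tight ends H' C ∧
      AgreeOff ends H H' C ∧ (∀ u ∈ C, deg ends H' u ≤ max 5 (deg ends H u)) ∧
      deg ends H' z + 1 = deg ends H z := by
  obtain ⟨A, hAU, hxA, hA, Hx, hHxE, hHx, hHxA, hxoff, hxdeg, hxx⟩ := hx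
  obtain ⟨B, hBU, hyB, hB, Hy, hHyE, hHy, hHyB, hyoff, hydeg, hyy⟩ := hy
  have hzA : z ∉ A := fun h => (mem_sdiff.1 (hAU h)).2 hzU
  have hzB : z ∉ B := fun h => (mem_sdiff.1 (hBU h)).2 hzU
  have hAB : Disjoint A B := by
    rw [disjoint_iff_inter_eq_empty]
    by_contra hne
    have := hmin _ (hA.union hH hB (nonempty_iff_ne_empty.2 hne)) (mem_union_left _ hxA)
      (mem_union_right _ hyB) hzX
    rcases mem_union.1 this with h | h
    exacts [hzA h, hzB h]
  have hxB : x ∉ B := disjoint_left.1 hAB hxA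
  have hyA : y ∉ A := disjoint_right.1 hAB hyB
  have hHxB : Tight ends Hx B := hB.congr (hxoff.inside_eq hAB.symm)
  set K := replace ends Hx Hy B with hK
  have hKs : Sparse ends K := hHx.replace hHy hHxB
  have hKE : K ⊆ E := union_subset (sdiff_subset.trans hHxE) (inside_subset.trans hHyE)
  have hKoff : AgreeOff ends Hx K B := fun g hg => by rw [hK, mem_replace]; tauto
  have hKB : Tight ends K B := hHyB.congr (inside_replace_of_subset subset_rfl)
  have hKA : Tight ends K A := hHxA.congr (hKoff.inside_eq hAB)
  have hKH : ∀ g, (¬ ∀ x ∈ ends g, x ∈ A) → (¬ ∀ x ∈ ends g, x ∈ B) → (g ∈ K ↔ g ∈ H) :=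
    fun g h1 h2 => (hKoff g h2).trans (hxoff g h1)
  have heK : e ∉ K := by
    rw [hKH e (fun h => hyA (h y (by simp [he]))) (fun h => hxB (h x (by simp [he])))]
    exact heH
  have htrans : ∀ X, A ⊆ X → B ⊆ X → (Tight ends H X ↔ Tight ends K X) := fun X h1 h2 =>
    ⟨fun h => hKoff.tight hHxB hKB h2 (hxoff.tight hA hHxA h1 h),
      fun h => hxoff.symm.tight hHxA hA h1 (hKoff.symm.tight hKB hHxB h2 h)⟩
  set C := X₀ ∪ A ∪ B with hC
  have hAC : A ⊆ C := subset_union_right.trans subset_union_left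
  have hBC : B ⊆ C := subset_union_right
  have hX₀C : X₀ ⊆ C := subset_union_left.trans subset_union_left
  have hHC : Tight ends H C :=
    (hX₀.union hH hA ⟨x, mem_inter.2 ⟨hxX, hxA⟩⟩).union hH hB
      ⟨y, mem_inter.2 ⟨mem_union_left _ hyX, hyB⟩⟩
  have hKC : Tight ends K C := (htrans C hAC hBC).1 hHC
  obtain ⟨X₁, hX₁, hxX₁, hyX₁, hmin₁⟩ := hKs.exists_minimal_tight hKC (hX₀C hxX) (hX₀C hyX)
  have hX₁C : X₁ ⊆ C := hmin₁ C hKC (hX₀C hxX) (hX₀C hyX)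
  -- The minimal tight set for `K` may differ from `X₀`, but its union with `A` and `B` is also
  -- tight for `H`. That union contains `X₀`, hence `z`, which lies in neither `A` nor `B`.
  have hzX₁ : z ∈ X₁ := by
    have h1 : Tight ends K (X₁ ∪ A ∪ B) :=
      (hX₁.union hKs hKA ⟨x, mem_inter.2 ⟨hxX₁, hxA⟩⟩).union hKs hKB
        ⟨y, mem_inter.2 ⟨mem_union_left _ hyX₁, hyB⟩⟩
    have h2 := hmin _ ((htrans _ (subset_union_right.trans subset_union_left)
      subset_union_right).2 h1) (by simp [hxA]) (by simp [hyB]) hzX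
    simp only [mem_union] at h2
    tauto
  have hxz : x ≠ z := by rintro rfl; exact hzA hxA
  have hyz : y ≠ z := by rintro rfl; exact hzB hyB
  obtain ⟨f, hf, hzf⟩ := hX₁.exists_mem_ends hKs hzX₁ hxX₁ hxz
  have hfK : f ∈ K := inside_subset hf
  have heKf : e ∉ K.erase f := fun h => heK (mem_of_mem_erase h)
  have hfe : f ≠ e := by rintro rfl; exact heK hfK
  have hfC : ∀ x ∈ ends f, x ∈ C := fun x hx => hX₁C ((mem_inside.1 hf).2 x hx)
  have heC : ∀ x ∈ ends e, x ∈ C := by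
    rw [he]; simp [hX₀C hxX, hX₀C hyX]
  have hdeg : ∀ u, deg ends (insert e (K.erase f)) u + (if u ∈ ends f then 1 else 0) =
      deg ends K u + (if u ∈ ends e then 1 else 0) := by
    intro u
    have := deg_erase (ends := ends) hfK u
    rw [deg_insert heKf]
    omega
  refine ⟨C, hHC, hX₀C, ?_, insert e (K.erase f), insert_subset heE ((erase_subset _ _).trans hKE),
    hKs.exchange he hmin₁ hf, ⟨hKC.1, ?_⟩, ?_, ?_, ?_⟩
  · exact union_subset (union_subset subset_union_left (hAU.trans subset_union_right))
      (hBU.trans subset_union_right)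
  · have h1 : inside ends (insert e (K.erase f)) C = insert e ((inside ends K C).erase f) := by
      ext g
      simp only [mem_inside, mem_insert, mem_erase]
      constructor
      · tauto
      · rintro (rfl | h)
        exacts [⟨Or.inl rfl, heC⟩, ⟨Or.inr ⟨h.1, h.2.1⟩, h.2.2⟩]
    rw [h1, card_insert_of_notMem, card_erase_add_one (mem_inside.2 ⟨hfK, hfC⟩)]
    · exact hKC.2
    · simp [mem_inside, heK]
  · intro g hg
    rw [mem_insert, mem_erase]
    have h1 : g ≠ e := by rintro rfl; exact hg heC
    have h2 : g ≠ f := by rintro rfl; exact hg hfC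
    have h3 := hKH g (fun h => hg fun x hx => hAC (h x hx)) (fun h => hg fun x hx => hBC (h x hx))
    tauto
  · intro u _
    have hu := hdeg u
    rw [he] at hu
    by_cases huA : u ∈ A
    · have h1 : deg ends K u = deg ends Hx u := hKoff.deg_eq (disjoint_left.1 hAB huA)
      have h2 := hxdeg u huA
      have h3 : u ≠ y := by rintro rfl; exact hyA huA
      by_cases hux : u = x
      · subst hux
        simp at hu
        omega
      · simp [hux, h3] at hu
        omega
    by_cases huB : u ∈ B
    · have h1 : deg ends K u = deg ends Hy u := by
        refine deg_congr fun g hg => ?_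
        have h1 := hxoff g fun h => huA (h u hg)
        have h2 := hyoff g
        rw [hK, mem_replace]
        tauto
      have h2 := hydeg u huB
      have h3 : u ≠ x := by rintro rfl; exact huA hxA
      by_cases huy : u = y
      · subst huy
        simp at hu
        omega
      · simp [huy, h3] at hu
        omega
    · have h1 : deg ends K u = deg ends H u :=
        deg_congr fun g hg => hKH g (fun h => huA (h u hg)) (fun h => huB (h u hg))
      have h2 : u ≠ x := by rintro rfl; exact huA hxA
      have h3 : u ≠ y := by rintro rfl; exact huB hyB
      simp [h2, h3] at hu
      omega
  · have hu := hdeg z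
    have h1 : deg ends K z = deg ends H z :=
      deg_congr fun g hg => hKH g (fun h => hzA (h z hg)) (fun h => hzB (h z hg))
    rw [he] at hu
    simp [hzf, hxz.symm, hyz.symm] at hu
    omega

/-- The increasing sequence of vertex sets that starts with the vertices of degree at least `6` and
in each step adds the vertices which are not reducible. -/
noncomputable def obstruction (ends : β → Sym2 α) (E H : Finset β) (V : Finset α) : ℕ → Finset α
  | 0 => V.filter fun v => 6 ≤ deg ends H v
  | n + 1 => obstruction ends E H V n ∪
      V.filter fun v => ¬ Reducible ends E H V (obstruction ends E H V n) v

theorem obstruction_zero_subset (E H : Finset β) (V : Finset α) (n : ℕ) :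
    obstruction ends E H V 0 ⊆ obstruction ends E H V n := by
  induction n with
  | zero => rfl
  | succ n ih => exact ih.trans subset_union_left

theorem obstruction_subset (E H : Finset β) (V : Finset α) (n : ℕ) :
    obstruction ends E H V n ⊆ V := by
  induction n with
  | zero => exact filter_subset _ _
  | succ n ih => exact union_subset ih (filter_subset _ _)

/-- `S` is the union of the obstruction sequence for an `H` of least excess. If the minimal tight
set around an unused edge avoiding `S` met `S`, take the first stage n at which it does. The swap
lowers a degree at a vertex `z` of that stage: for n = 0 this reduces the excess, and for n > 0 it
makes `z` reducible with respect to stage n - 1. Both are impossible. -/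
theorem exists_deg_le_five_or_obstruction {E H₀ : Finset β} {V : Finset α} (hH₀E : H₀ ⊆ E)
    (hH₀ : Sparse ends H₀) (hH₀V : Tight ends H₀ V) :
    ∃ H ⊆ E, Sparse ends H ∧ Tight ends H V ∧ ((∀ v ∈ V, deg ends H v ≤ 5) ∨
      ∃ S ⊆ V, (∀ v ∈ S, 5 ≤ deg ends H v) ∧ (∃ v ∈ S, 6 ≤ deg ends H v) ∧
        ∀ e ∈ E, e ∉ H → (∀ x ∈ ends e, x ∈ V \ S) →
          ∃ X ⊆ V \ S, Tight ends H X ∧ ∀ x ∈ ends e, x ∈ X) := by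
  obtain ⟨H, hHm, hopt⟩ := exists_min_image
    (E.powerset.filter fun H => Sparse ends H ∧ Tight ends H V)
    (fun H => ∑ v ∈ V, (deg ends H v - 5)) ⟨H₀, by simp [*]⟩
  simp only [mem_filter, mem_powerset, and_imp] at hHm hopt
  obtain ⟨hHE, hH, hHV⟩ := hHm
  refine ⟨H, hHE, hH, hHV, ?_⟩
  by_cases hdeg : ∀ v ∈ V, deg ends H v ≤ 5
  · exact Or.inl hdeg
  right
  push Not at hdeg
  obtain ⟨w, hwV, hw⟩ := hdeg
  set U := obstruction ends E H V with hU
  have hmem : ∀ v, v ∈ V.filter (fun v => ∃ n, v ∈ U n) ↔ ∃ n, v ∈ U n := fun v => by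
    simp only [mem_filter, and_iff_right_iff_imp]
    rintro ⟨n, hn⟩
    exact obstruction_subset E H V n hn
  have hdeg5 : ∀ n, ∀ v ∈ U n, 5 ≤ deg ends H v := by
    intro n
    induction n with
    | zero => exact fun v hv => by have := (mem_filter.1 hv).2; omega
    | succ n ih =>
      intro v hv
      by_cases hvn : v ∈ U n
      · exact ih v hvn
      by_contra hlt
      rcases mem_union.1 hv with h | h
      · exact hvn h
      rw [mem_filter] at h
      -- A vertex of degree at most 4 is reducible with the singleton as tight set and `H`
      -- unchanged.
      refine h.2 ⟨{v}, by simp [h.1]; exact hvn, by simp, hH.tight_singleton v, H, hHE, hH,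
        hH.tight_singleton v, fun _ _ => Iff.rfl, ?_, by omega⟩
      simp only [mem_singleton, forall_eq]
      omega
  refine ⟨V.filter fun v => ∃ n, v ∈ U n, filter_subset _ _, ?_, ⟨w, ?_, hw⟩, ?_⟩
  · intro v hv
    obtain ⟨n, hn⟩ := (hmem v).1 hv
    exact hdeg5 n v hn
  · exact (hmem w).2 ⟨0, mem_filter.2 ⟨hwV, hw⟩⟩
  intro e heE heH heV
  induction he : ends e with | _ x y =>
  simp only [he, Sym2.mem_iff, forall_eq_or_imp, forall_eq, mem_sdiff, hmem, not_exists] at heV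
  obtain ⟨⟨hxV, hxU⟩, hyV, hyU⟩ := heV
  obtain ⟨X₀, hX₀, hxX, hyX, hmin⟩ := hH.exists_minimal_tight hHV hxV hyV
  have hX₀V : X₀ ⊆ V := hmin V hHV hxV hyV
  refine ⟨X₀, ?_, hX₀, by simp [hxX, hyX]⟩
  by_contra hsub
  have hex : ∃ n, ∃ z ∈ X₀, z ∈ U n := by
    by_contra! hcon
    refine hsub fun z hz => mem_sdiff.2 ⟨hX₀V hz, fun h => ?_⟩
    obtain ⟨n, hn⟩ := (hmem z).1 h
    exact hcon n z hz hn
  have hred : ∀ n v, v ∈ V → (∀ m, v ∉ U m) → Reducible ends E H V (U n) v := by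
    intro n v hvV hv
    by_contra hn
    exact hv (n + 1) (mem_union_right _ (mem_filter.2 ⟨hvV, hn⟩))
  obtain ⟨z, hzX, hzU⟩ := Nat.find_spec hex
  have hfirst := fun m => Nat.find_min hex (m := m)
  set n := Nat.find hex with hn
  clear_value n
  obtain ⟨C, hC, hX₀C, hCV, H', hH'E, hH', hH'C, hoff, hH'deg, hH'z⟩ :=
    Reducible.exists_swap hH heE heH he (hred n x hxV hxU) (hred n y hyV hyU) hX₀ hxX hyX hmin
      hzX hzU
  have hCV' : C ⊆ V := hCV.trans (union_subset hX₀V sdiff_subset)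
  cases n with
  | zero =>
    have h1 := hopt H' hH'E hH' (hoff.tight hC hH'C hCV' hHV)
    have h6 : 6 ≤ deg ends H z := (mem_filter.1 hzU).2
    refine absurd h1 (not_le.2 (sum_lt_sum (fun u _ => ?_) ⟨z, hX₀V hzX, by omega⟩))
    by_cases hu : u ∈ C
    · have := hH'deg u hu
      omega
    · rw [hoff.deg_eq hu]
  | succ n =>
    have hno : ∀ u ∈ X₀, u ∉ U n := fun u hu hun => hfirst n (Nat.lt_succ_self n) ⟨u, hu, hun⟩
    have hzn := hno z hzX
    have hCn : C ⊆ V \ U n := by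
      refine hCV.trans (union_subset (fun u hu => mem_sdiff.2 ⟨hX₀V hu, hno u hu⟩) ?_)
      exact sdiff_subset_sdiff subset_rfl subset_union_left
    have hle : ∀ u ∈ V \ U n, deg ends H u ≤ 5 := by
      intro u hu
      by_contra hlt
      rw [mem_sdiff] at hu
      exact hu.2 (obstruction_zero_subset E H V n (mem_filter.2 ⟨hu.1, by omega⟩))
    rcases mem_union.1 hzU with h | h
    · exact hzn h
    refine (mem_filter.1 h).2 ⟨C, hCn, hX₀C hzX, hC, H', hH'E, hH', hH'C, hoff, fun u hu => ?_, ?_⟩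
    · have := hH'deg u hu
      have := hle u (hCn hu)
      omega
    · have := hle z (hCn (hX₀C hzX))
      omega

/-! ### The partition into maximal tight sets -/

/-- The edges of `F` inside `U` whose ends belong to different classes of `π`. -/
noncomputable def crossing (ends : β → Sym2 α) (F : Finset β) (U : Finset α) (π : α → ι) :
    Finset β :=
  (inside ends F U).filter fun e => ∃ x ∈ ends e, ∃ y ∈ ends e, π x ≠ π y

theorem mem_crossing {F : Finset β} {U : Finset α} {π : α → ι} {e : β} :
    e ∈ crossing ends F U π ↔
      e ∈ F ∧ (∀ x ∈ ends e, x ∈ U) ∧ ∃ x ∈ ends e, ∃ y ∈ ends e, π x ≠ π y := by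
  rw [crossing, mem_filter, mem_inside, and_assoc]

theorem crossing_mono {F F' : Finset β} {U U' : Finset α} (π : α → ι) (hF : F ⊆ F') (hU : U ⊆ U') :
    crossing ends F U π ⊆ crossing ends F' U' π :=
  filter_subset_filter _ (inside_mono hF hU)

theorem Sparse.exists_maximal_tight {H : Finset β} (hH : Sparse ends H) {U : Finset α} {v : α}
    (hv : v ∈ U) : ∃ P ⊆ U, Tight ends H P ∧ v ∈ P ∧ ∀ X ⊆ U, Tight ends H X → v ∈ X → X ⊆ P := by
  obtain ⟨P, hP, hmax⟩ := exists_max_image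
    (U.powerset.filter fun X => Tight ends H X ∧ v ∈ X) card
    ⟨{v}, by simp [hv, hH.tight_singleton]⟩
  simp only [mem_filter, mem_powerset] at hP hmax
  refine ⟨P, hP.1, hP.2.1, hP.2.2, fun X hX hXt hvX => ?_⟩
  have h1 := hmax (P ∪ X) ⟨union_subset hP.1 hX,
    hP.2.1.union hH hXt ⟨v, mem_inter.2 ⟨hP.2.2, hvX⟩⟩, mem_union_left _ hP.2.2⟩
  rw [eq_of_subset_of_card_le subset_union_left h1]
  exact subset_union_right

/-- Tight sets that meet have a tight union and singletons are tight, so the maximal tight subsets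
of `U` partition it. The map `π` sends a vertex to its class, and the count is the sum of the
tightness equations over the classes. -/
theorem Sparse.exists_partition {H : Finset β} (hH : Sparse ends H) (U : Finset α) :
    ∃ π : α → Finset α, (∀ X ⊆ U, Tight ends H X → ∀ x ∈ X, ∀ y ∈ X, π x = π y) ∧
      #(inside ends H U) + 2 * #(U.image π) = 2 * #U + #(crossing ends H U π) := by
  choose! π hπU hπt hπv hπmax using fun v (hv : v ∈ U) => hH.exists_maximal_tight hv
  have heq : ∀ v ∈ U, ∀ w ∈ π v, π w = π v := by
    intro v hv w hw
    have hwU := hπU v hv hw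
    have h1 := hπmax w hwU _ (hπU v hv) (hπt v hv) hw
    exact (hπmax v hv _ (hπU w hwU) (hπt w hwU) (h1 (hπv v hv))).antisymm h1
  refine ⟨π, fun X hX hXt x hx y hy => (heq x (hX hx) y (hπmax x (hX hx) X hX hXt hx hy)).symm, ?_⟩
  have hfib : ∀ X ∈ U.image π, U.filter (fun v => π v = X) = X := by
    intro X hX
    obtain ⟨v, hv, rfl⟩ := mem_image.1 hX
    ext w
    rw [mem_filter]
    exact ⟨fun h => h.2 ▸ hπv w h.1, fun h => ⟨hπU v hv h, heq v hv w h⟩⟩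
  have h1 : #U = ∑ X ∈ U.image π, #X := by
    rw [card_eq_sum_card_image π U]
    exact sum_congr rfl fun X hX => by rw [hfib X hX]
  set N := (inside ends H U).filter fun e => ¬ ∃ x ∈ ends e, ∃ y ∈ ends e, π x ≠ π y with hN
  have h2 : #(crossing ends H U π) + #N = #(inside ends H U) := card_filter_add_card_filter_not _
  have h3 : #N = ∑ X ∈ U.image π, #(inside ends H X) := by
    rw [card_eq_sum_card_fiberwise (f := fun e => π (ends e).out.1) (t := U.image π)]
    · refine sum_congr rfl fun X hX => congrArg card ?_
      ext e
      simp only [hN, mem_filter, mem_inside, not_exists, not_and, not_not]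
      have ho := Sym2.out_fst_mem (ends e)
      constructor
      · rintro ⟨⟨⟨heH, heU⟩, heq⟩, rfl⟩
        exact ⟨heH, fun x hx => heq x hx _ ho ▸ hπv x (heU x hx)⟩
      · rintro ⟨heH, heX⟩
        have hX' : ∀ x ∈ ends e, x ∈ U ∧ π x = X := by
          intro x hx
          have := heX x hx
          rw [← hfib X hX, mem_filter] at this
          exact this
        exact ⟨⟨⟨heH, fun x hx => (hX' x hx).1⟩,
          fun x hx y hy => (hX' x hx).2.trans (hX' y hy).2.symm⟩, (hX' _ ho).2⟩
    · intro e he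
      rw [mem_coe, hN, mem_filter, mem_inside] at he
      exact mem_coe.2 (mem_image_of_mem _ (he.1.2 _ (Sym2.out_fst_mem _)))
  have h4 : ∑ X ∈ U.image π, (#(inside ends H X) + 2) = ∑ X ∈ U.image π, 2 * #X := by
    refine sum_congr rfl fun X hX => ?_
    obtain ⟨v, hv, rfl⟩ := mem_image.1 hX
    exact (hπt v hv).2
  rw [sum_add_distrib, ← mul_sum, ← h1, ← h3, sum_const, smul_eq_mul] at h4
  omega

theorem crossing_eq_of_subset {E H : Finset β} {U : Finset α} {π : α → ι} (hHE : H ⊆ E)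
    (h : ∀ e ∈ E, e ∉ H → (∀ x ∈ ends e, x ∈ U) → ∀ x ∈ ends e, ∀ y ∈ ends e, π x = π y) :
    crossing ends E U π = crossing ends H U π := by
  refine Subset.antisymm (fun e he => ?_) (crossing_mono π hHE subset_rfl)
  rw [mem_crossing] at he ⊢
  refine ⟨?_, he.2⟩
  by_contra heH
  obtain ⟨x, hx, y, hy, hxy⟩ := he.2.2
  exact hxy (h e he.1 heH he.2.1 x hx y hy)

/-! ### Deleting vertices to leave many components -/

/-- Some set `W` can be deleted from `U` so that the rest has `k` classes not joined by edges, where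
`2 |W| + m ≤ 7 k`. -/
def Splits (ends : β → Sym2 α) (E : Finset β) (U : Finset α) (m : ℤ) : Prop :=
  ∃ W ⊆ U, ∃ c : α → α, (∀ v ∈ U \ W, c v ∈ U \ W) ∧
    (∀ e ∈ inside ends E (U \ W), ∀ x ∈ ends e, ∀ y ∈ ends e, c x = c y) ∧
    2 * (#W : ℤ) + m ≤ 7 * #((U \ W).image c)

theorem Splits.mono {E : Finset β} {U : Finset α} {m m' : ℤ} (h : Splits ends E U m')
    (hm : m ≤ m') : Splits ends E U m := by
  obtain ⟨W, hW, c, h1, h2, h3⟩ := h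
  exact ⟨W, hW, c, h1, h2, by omega⟩

theorem splits_empty (E : Finset β) : Splits ends E ∅ 0 :=
  ⟨∅, subset_rfl, id, by simp, by
    intro e he
    exact fun x hx => absurd ((mem_inside.1 he).2 x hx) (by simp), by simp⟩

theorem Splits.of_erase {E : Finset β} {U : Finset α} {m : ℤ} {x : α} (hx : x ∈ U)
    (h : Splits ends E (U.erase x) m) : Splits ends E U (m - 2) := by
  obtain ⟨W, hW, c, h1, h2, h3⟩ := h
  have hxW : x ∉ W := fun h => by simpa using hW h
  have hU : U \ insert x W = U.erase x \ W := by
    ext y; simp only [mem_sdiff, mem_insert, mem_erase]; tauto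
  refine ⟨insert x W, insert_subset hx (hW.trans (erase_subset _ _)), c, ?_, ?_, ?_⟩
  · rwa [hU]
  · rwa [hU]
  · rw [hU, card_insert_of_notMem hxW]
    push_cast
    omega

/-- Deleting `N` isolates `C`, which receives a colour of its own. Colours are required to be
remaining vertices precisely so that `a` in `C` is a new one. -/
theorem Splits.of_sdiff {E : Finset β} {U C N : Finset α} {m : ℤ} (hC : C.Nonempty) (hCU : C ⊆ U)
    (hNU : N ⊆ U) (hCN : Disjoint C N)
    (hclosed : ∀ e ∈ inside ends E U, (∃ x ∈ ends e, x ∈ C) → ∀ x ∈ ends e, x ∈ C ∪ N)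
    (h : Splits ends E (U \ (C ∪ N)) m) : Splits ends E U (m + 7 - 2 * #N) := by
  obtain ⟨W, hW, c, h1, h2, h3⟩ := h
  obtain ⟨a, ha⟩ := hC
  set R := (U \ (C ∪ N)) \ W with hR
  have hCW : ∀ x ∈ C, x ∉ W := fun x hx hxW => by have := hW hxW; simp [hx] at this
  have hU : U \ (W ∪ N) = C ∪ R := by
    ext y
    have : y ∈ C → y ∈ U := fun h => hCU h
    have := hCW y
    have : y ∈ C → y ∉ N := fun h => disjoint_left.1 hCN h
    simp only [hR, mem_sdiff, mem_union]
    tauto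
  have hRC : ∀ x ∈ R, x ∉ C := fun x hx => by simp only [hR, mem_sdiff, mem_union] at hx; tauto
  refine ⟨W ∪ N, union_subset (hW.trans sdiff_subset) hNU, fun v => if v ∈ C then a else c v,
    ?_, ?_, ?_⟩
  · intro v hv
    rw [hU] at hv ⊢
    dsimp only
    split_ifs with hvC
    · exact mem_union_left _ ha
    · exact mem_union_right _ (h1 v ((mem_union.1 hv).resolve_left hvC))
  · intro e he
    rw [mem_inside] at he
    by_cases hex : ∃ x ∈ ends e, x ∈ C
    · have hin : ∀ x ∈ ends e, x ∈ C := by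
        intro x hx
        have h4 := he.2 x hx
        have h5 := hclosed e (mem_inside.2 ⟨he.1, fun x hx => (mem_sdiff.1 (he.2 x hx)).1⟩) hex x hx
        simp only [mem_sdiff, mem_union] at h4 h5
        tauto
      intro x hx y hy
      beta_reduce
      rw [if_pos (hin x hx), if_pos (hin y hy)]
    · push Not at hex
      intro x hx y hy
      beta_reduce
      rw [if_neg (hex x hx), if_neg (hex y hy)]
      refine h2 e (mem_inside.2 ⟨he.1, fun z hz => ?_⟩) x hx y hy
      have := he.2 z hz
      rw [hU] at this
      exact (mem_union.1 this).resolve_left (hex z hz)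
  · have h4 : insert a (R.image c) ⊆ (C ∪ R).image fun v => if v ∈ C then a else c v := by
      refine insert_subset (mem_image.2 ⟨a, mem_union_left _ ha, by simp [ha]⟩) fun y hy => ?_
      obtain ⟨x, hx, rfl⟩ := mem_image.1 hy
      exact mem_image.2 ⟨x, mem_union_right _ hx, by simp [hRC x hx]⟩
    have h5 : a ∉ R.image c := by
      intro h
      obtain ⟨x, hx, hxa⟩ := mem_image.1 h
      exact hRC a (hxa ▸ h1 x hx) ha
    have h6 := card_le_card h4
    rw [card_insert_of_notMem h5] at h6
    have h7 := card_union_le W N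
    rw [hU]
    omega

theorem card_inside_sdiff_add_le {E : Finset β} {U R : Finset α} {T : Finset β}
    (hT : ∀ e ∈ T, e ∈ inside ends E U ∧ ∃ x ∈ ends e, x ∈ R) :
    #(inside ends E (U \ R)) + #T ≤ #(inside ends E U) := by
  rw [← card_union_of_disjoint]
  · exact card_le_card (union_subset (inside_mono subset_rfl sdiff_subset) fun e he => (hT e he).1)
  · rw [disjoint_left]
    intro e he heT
    obtain ⟨x, hx, hxR⟩ := (hT e heT).2
    exact (mem_sdiff.1 ((mem_inside.1 he).2 x hx)).2 hxR

/-- The balance of one peeling step: the new class earns 7, each destroyed edge in `T` earns 2, a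
vertex of `C` costs 4, and a vertex of `N` costs 4 plus 2 for its deletion. -/
theorem Splits.of_sdiff_of_card {E : Finset β} {U C N : Finset α} {T : Finset β} {k : ℤ}
    (hC : C.Nonempty) (hCU : C ⊆ U) (hNU : N ⊆ U) (hCN : Disjoint C N)
    (hclosed : ∀ e ∈ inside ends E U, (∃ x ∈ ends e, x ∈ C) → ∀ x ∈ ends e, x ∈ C ∪ N)
    (hT : ∀ e ∈ T, e ∈ inside ends E U ∧ ∃ x ∈ ends e, x ∈ C ∪ N)
    (h : Splits ends E (U \ (C ∪ N))
      (4 * #(U \ (C ∪ N)) - 2 * #(inside ends E (U \ (C ∪ N))) + k)) :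
    Splits ends E U (4 * #U - 2 * #(inside ends E U) + (2 * #T + 7 + k - 4 * #C - 6 * #N)) := by
  refine (h.of_sdiff hC hCU hNU hCN hclosed).mono ?_
  have h1 := card_inside_sdiff_add_le hT
  have h2 : #(U \ (C ∪ N)) + #(C ∪ N) = #U := card_sdiff_add_card_eq_card (union_subset hCU hNU)
  have h3 := card_union_of_disjoint hCN
  omega

/-- The components are paths and cycles. Peeling an isolated vertex, an end of a path, a digon or a
triangle has positive balance. Opening a longer cycle has balance -1, so the induction carries a
bonus of 1 whenever some vertex has degree at most 1. The five-cycle shows that 7 is exact: two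
vertices are deleted, two classes remain, and 4 + 20 - 10 = 14. -/
theorem splits_of_deg_le_two {E : Finset β} (hl : ∀ e ∈ E, ¬ (ends e).IsDiag) (U : Finset α)
    (hd : ∀ v ∈ U, deg ends (inside ends E U) v ≤ 2) :
    Splits ends E U (4 * #U - 2 * #(inside ends E U) +
      if ∃ v ∈ U, deg ends (inside ends E U) v ≤ 1 then 1 else 0) := by
  induction U using Finset.strongInduction with | _ U ih =>
  have hsub : ∀ U' : Finset α, U' ⊆ U → ∀ v, deg ends (inside ends E U') v ≤
      deg ends (inside ends E U) v := fun U' h v => deg_mono (inside_mono subset_rfl h) v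
  have hIH : ∀ R : Finset α, R ⊆ U → R.Nonempty → Splits ends E (U \ R)
      (4 * #(U \ R) - 2 * #(inside ends E (U \ R)) +
        if ∃ v ∈ U \ R, deg ends (inside ends E (U \ R)) v ≤ 1 then 1 else 0) :=
    fun R hR hne => ih _ (sdiff_ssubset hR hne)
      fun v hv => (hsub _ sdiff_subset v).trans (hd v (mem_sdiff.1 hv).1)
  have hIH0 : ∀ R : Finset α, R ⊆ U → R.Nonempty → Splits ends E (U \ R)
      (4 * #(U \ R) - 2 * #(inside ends E (U \ R)) + 0) :=
    fun R hR hne => (hIH R hR hne).mono (by split_ifs <;> omega)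
  have hother : ∀ v, ∀ e ∈ (inside ends E U).filter (v ∈ ends ·),
      ∃ a ∈ U, a ≠ v ∧ ends e = s(v, a) := by
    intro v e he
    rw [mem_filter, mem_inside] at he
    obtain ⟨a, ha⟩ := he.2
    refine ⟨a, he.1.2 a (by simp [ha]), ?_, ha⟩
    rintro rfl
    exact hl e he.1.1 (by simp [ha])
  have hmem : ∀ v e, e ∈ (inside ends E U).filter (v ∈ ends ·) ↔
    e ∈ inside ends E U ∧ v ∈ ends e := fun v e => mem_filter
  by_cases h0 : ∃ v ∈ U, deg ends (inside ends E U) v = 0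
  · obtain ⟨v, hv, h0⟩ := h0
    have hnone : ∀ e ∈ inside ends E U, v ∉ ends e := fun e he hve => by
      have := (card_eq_zero.1 h0)
      exact notMem_empty e (this ▸ (hmem v e).2 ⟨he, hve⟩)
    have := Splits.of_sdiff_of_card (C := {v}) (N := ∅) (T := ∅) (singleton_nonempty v)
      (singleton_subset_iff.2 hv) (empty_subset _) (disjoint_empty_right _)
      (fun e he ⟨x, hx, hxv⟩ => absurd hx (mem_singleton.1 hxv ▸ hnone e he)) (by simp)
      (hIH0 _ (by simpa using hv) (by simp))
    exact this.mono (by simp; split_ifs <;> omega)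
  by_cases h1 : ∃ v ∈ U, deg ends (inside ends E U) v = 1
  · obtain ⟨v, hv, h1⟩ := h1
    obtain ⟨e, he⟩ := card_eq_one.1 h1
    have hev : e ∈ (inside ends E U).filter (v ∈ ends ·) := by rw [he]; simp
    have heU := ((hmem v e).1 hev).1
    obtain ⟨a, haU, hav, ha⟩ := hother v e hev
    have honly : ∀ f ∈ inside ends E U, v ∈ ends f → f = e := fun f hf hvf => by
      have := (hmem v f).2 ⟨hf, hvf⟩
      rwa [he, mem_singleton] at this
    by_cases ha1 : deg ends (inside ends E U) a = 1
    · obtain ⟨e', he'⟩ := card_eq_one.1 ha1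
      have honly' : ∀ f ∈ inside ends E U, a ∈ ends f → f = e := fun f hf hvf => by
        have h2 := (hmem a f).2 ⟨hf, hvf⟩
        have h3 := (hmem a e).2 ⟨heU, by simp [ha]⟩
        rw [he', mem_singleton] at h2 h3
        rw [h2, h3]
      have := Splits.of_sdiff_of_card (C := {v, a}) (N := ∅) (T := {e}) (by simp)
        (by simp [insert_subset_iff, hv, haU]) (empty_subset _) (disjoint_empty_right _)
        (fun f hf ⟨x, hx, hxv⟩ => by
          have : f = e := by
            rcases mem_insert.1 hxv with rfl | h
            · exact honly f hf hx
            · exact honly' f hf (mem_singleton.1 h ▸ hx)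
          simp [this, ha]) (by simp [heU, ha])
        (hIH0 _ (by simp [insert_subset_iff, hv, haU]) (by simp))
      rw [card_pair hav.symm] at this
      exact this.mono (by simp; split_ifs <;> omega)
    · have ha2 : deg ends (inside ends E U) a = 2 := by
        have := hd a haU
        have : deg ends (inside ends E U) a ≠ 0 := fun h => h0 ⟨a, haU, h⟩
        omega
      have := Splits.of_sdiff_of_card (C := {v}) (N := {a})
        (T := (inside ends E U).filter (a ∈ ends ·)) (by simp) (by simpa using hv)
        (by simpa using haU) (by simpa using hav.symm)
        (fun f hf ⟨x, hx, hxv⟩ => by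
          rw [honly f hf (mem_singleton.1 hxv ▸ hx), ha]
          simp) (fun f hf => ⟨((hmem a f).1 hf).1, a, ((hmem a f).1 hf).2, by simp⟩)
        (hIH0 _ (by simp [insert_subset_iff, hv, haU]) (by simp))
      rw [show #((inside ends E U).filter (a ∈ ends ·)) = 2 from ha2] at this
      exact this.mono (by simp; split_ifs <;> omega)
  have h2 : ∀ v ∈ U, deg ends (inside ends E U) v = 2 := by
    intro v hv
    have := hd v hv
    have : deg ends (inside ends E U) v ≠ 0 := fun h => h0 ⟨v, hv, h⟩
    have : deg ends (inside ends E U) v ≠ 1 := fun h => h1 ⟨v, hv, h⟩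
    omega
  rw [if_neg (by rintro ⟨v, hv, h⟩; have := h2 v hv; omega)]
  rcases U.eq_empty_or_nonempty with rfl | ⟨v, hv⟩
  · exact (splits_empty E).mono (by simp)
  have two : ∀ v ∈ U, ∀ e ∈ inside ends E U, v ∈ ends e → ∃ f ∈ inside ends E U, f ≠ e ∧
      v ∈ ends f ∧ ∀ g ∈ inside ends E U, v ∈ ends g → g = e ∨ g = f := by
    intro v hv e he hve
    have h3 : #(((inside ends E U).filter (v ∈ ends ·)).erase e) = 1 := by
      rw [card_erase_of_mem ((hmem v e).2 ⟨he, hve⟩)]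
      have : #((inside ends E U).filter (v ∈ ends ·)) = 2 := h2 v hv
      omega
    obtain ⟨f, hf⟩ := card_eq_one.1 h3
    have hff : f ∈ ((inside ends E U).filter (v ∈ ends ·)).erase e := by rw [hf]; simp
    rw [mem_erase, hmem] at hff
    refine ⟨f, hff.2.1, hff.1, hff.2.2, fun g hg hvg => ?_⟩
    by_cases hge : g = e
    · exact Or.inl hge
    · right
      have : g ∈ ((inside ends E U).filter (v ∈ ends ·)).erase e :=
        mem_erase.2 ⟨hge, (hmem v g).2 ⟨hg, hvg⟩⟩
      rwa [hf, mem_singleton] at this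
  obtain ⟨e, he⟩ : ((inside ends E U).filter (v ∈ ends ·)).Nonempty :=
    card_pos.1 (by have : #((inside ends E U).filter (v ∈ ends ·)) = 2 := h2 v hv
                   omega)
  obtain ⟨b, hbU, hbv, hb⟩ := hother v e he
  have heU := ((hmem v e).1 he).1
  obtain ⟨f, hfU, hfe, hvf, hv2⟩ := two v hv e heU (by simp [hb])
  obtain ⟨c, hcU, hcv, hc⟩ := hother v f ((hmem v f).2 ⟨hfU, hvf⟩)
  obtain ⟨g, hgU, hge, hbg, hb2⟩ := two b hbU e heU (by simp [hb])
  obtain ⟨d, hdU, hdb, hd'⟩ := hother b g ((hmem b g).2 ⟨hgU, hbg⟩)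
  by_cases hbc : b = c
  · subst hbc
    have hgf : g = f := by
      rcases hb2 f hfU (by simp [hc]) with h | h
      exacts [absurd h hfe, h.symm]
    subst hgf
    have := Splits.of_sdiff_of_card (C := {v, b}) (N := ∅) (T := {e, g}) (by simp)
      (by simp [insert_subset_iff, hv, hbU]) (empty_subset _) (disjoint_empty_right _)
      (fun k hk ⟨x, hx, hxv⟩ => by
        have : k = e ∨ k = g := by
          rcases mem_insert.1 hxv with rfl | h
          · exact hv2 k hk hx
          · exact hb2 k hk (mem_singleton.1 h ▸ hx)
        rcases this with rfl | rfl <;> simp [hb, hc])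
      (by simp [heU, hgU, hb, hc])
      (hIH0 _ (by simp [insert_subset_iff, hv, hbU]) (by simp))
    rw [card_pair hbv.symm, card_pair hge.symm] at this
    exact this.mono (by simp)
  have hgf : g ≠ f := by
    rintro rfl
    rw [hc, Sym2.mem_iff] at hbg
    exact hbg.elim hbv hbc
  have hdv : d ≠ v := by
    rintro rfl
    rcases hv2 g hgU (by simp [hd']) with h | h
    exacts [hge h, hgf h]
  by_cases hdc : d = c
  · subst hdc
    have hdd : ∀ k ∈ inside ends E U, d ∈ ends k → k = f ∨ k = g := by
      obtain ⟨g', hg', hg'f, hdg', hd2⟩ := two d hdU f hfU (by simp [hc])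
      rcases hd2 g hgU (by simp [hd']) with h | h
      · exact absurd h hgf
      · rw [h]; exact hd2
    have := Splits.of_sdiff_of_card (C := {v, b, d}) (N := ∅) (T := {e, f, g}) (by simp)
      (by simp [insert_subset_iff, hv, hbU, hdU]) (empty_subset _) (disjoint_empty_right _)
      (fun k hk ⟨x, hx, hxv⟩ => by
        have : k = e ∨ k = f ∨ k = g := by
          simp only [mem_insert, mem_singleton] at hxv
          rcases hxv with rfl | rfl | rfl
          · have := hv2 k hk hx; tauto
          · have := hb2 k hk hx; tauto
          · have := hdd k hk hx; tauto
        rcases this with rfl | rfl | rfl <;> simp [hb, hc, hd'])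
      (by simp [heU, hfU, hgU, hb, hc, hd'])
      (hIH0 _ (by simp [insert_subset_iff, hv, hbU, hdU]) (by simp))
    rw [card_eq_three.2 ⟨v, b, d, hbv.symm, hdv.symm, hbc, rfl⟩,
      card_eq_three.2 ⟨e, f, g, hfe.symm, hge.symm, hgf.symm, rfl⟩] at this
    exact this.mono (by simp)
  obtain ⟨k, hkU, hkg, hdk, hd2⟩ := two d hdU g hgU (by simp [hd'])
  have hke : k ≠ e := by
    rintro rfl
    rw [hb, Sym2.mem_iff] at hdk
    exact hdk.elim hdv hdb
  have hkf : k ≠ f := by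
    rintro rfl
    rw [hc, Sym2.mem_iff] at hdk
    exact hdk.elim hdv hdc
  have hRU : ({b} ∪ {v, d} : Finset α) ⊆ U := by simp [insert_subset_iff, hv, hbU, hdU]
  have hcR : c ∈ U \ ({b} ∪ {v, d} : Finset α) := by
    simp [hcU, hcv, Ne.symm hdc, Ne.symm hbc]
  have hcdeg : deg ends (inside ends E (U \ ({b} ∪ {v, d}))) c ≤ 1 := by
    have h3 : (inside ends E (U \ ({b} ∪ {v, d}))).filter (c ∈ ends ·) ⊆
        ((inside ends E U).filter (c ∈ ends ·)).erase f := by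
      intro j hj
      rw [mem_filter] at hj
      refine mem_erase.2 ⟨?_, (hmem c j).2 ⟨inside_mono subset_rfl sdiff_subset hj.1, hj.2⟩⟩
      rintro rfl
      have := (mem_inside.1 hj.1).2 v (by simp [hc])
      simp at this
    have h4 := card_le_card h3
    rw [card_erase_of_mem ((hmem c f).2 ⟨hfU, by simp [hc]⟩)] at h4
    have h5 : #((inside ends E U).filter (c ∈ ends ·)) = 2 := h2 c hcU
    rw [h5] at h4
    exact h4
  -- Here the balance is 8 + 7 - 4 - 12 = -1. The bonus repays it, because `c` has lost the edge `f`
  -- to `v` and now has degree at most 1.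
  have hrec := hIH _ hRU (by simp)
  rw [if_pos ⟨c, hcR, hcdeg⟩] at hrec
  have := Splits.of_sdiff_of_card (C := {b}) (N := {v, d}) (T := {e, f, g, k}) (by simp)
    (by simpa using hbU) (by simp [insert_subset_iff, hv, hdU])
    (by simp [hbv, hdb.symm])
    (fun j hj ⟨x, hx, hxv⟩ => by
      rcases hb2 j hj (mem_singleton.1 hxv ▸ hx) with rfl | rfl <;> simp [hb, hd'])
    (by simp [heU, hfU, hgU, hkU, hb, hc, hd']; exact ⟨d, hdk, by simp⟩) hrec
  rw [card_pair hdv.symm, card_insert_of_notMem (by simp [hfe.symm, hge.symm, hke.symm]),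
    card_eq_three.2 ⟨f, g, k, hgf.symm, hkf.symm, hkg.symm, rfl⟩] at this
  exact this.mono (by simp)

/-- Deleting a vertex costs 2. It pays off if the vertex meets a crossing edge and its class has
another vertex, since no class is lost, or if it meets three crossing edges, since 6 ≥ 4 + 2. When
neither occurs, a class with two or more vertices is joined to nothing and counts as a component,
gaining 7 - 4. What remains is singleton classes with all degrees at most 2. -/
theorem splits_of_partition [DecidableEq ι] {E : Finset β} (hl : ∀ e ∈ E, ¬ (ends e).IsDiag)
    (U : Finset α)
    (π : α → ι) : Splits ends E U (4 * #(U.image π) - 2 * #(crossing ends E U π)) := by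
  induction U using Finset.strongInduction with | _ U ih =>
  have herase : ∀ x ∈ U, #(crossing ends E (U.erase x) π) + deg ends (crossing ends E U π) x ≤
      #(crossing ends E U π) := by
    intro x hx
    rw [deg, ← card_union_of_disjoint]
    · exact card_le_card (union_subset (crossing_mono π subset_rfl (erase_subset _ _))
        (filter_subset _ _))
    · rw [disjoint_left]
      intro e he he'
      simpa using (mem_crossing.1 he).2.1 x (mem_filter.1 he').2
  by_cases hA : ∃ x ∈ U, (∃ y ∈ U, y ≠ x ∧ π y = π x) ∧ 1 ≤ deg ends (crossing ends E U π) x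
  · obtain ⟨x, hx, ⟨y, hy, hyx, hπ⟩, hdx⟩ := hA
    refine ((ih _ (erase_ssubset hx)).of_erase hx).mono ?_
    have h1 : (U.erase x).image π = U.image π := by
      refine Subset.antisymm (image_subset_image (erase_subset _ _)) fun i hi => ?_
      obtain ⟨z, hz, rfl⟩ := mem_image.1 hi
      by_cases hzx : z = x
      · exact mem_image.2 ⟨y, mem_erase.2 ⟨hyx, hy⟩, by rw [hπ, hzx]⟩
      · exact mem_image_of_mem _ (mem_erase.2 ⟨hzx, hz⟩)
    have h2 := herase x hx
    rw [h1]
    omega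
  by_cases hB : ∃ x ∈ U, 3 ≤ deg ends (crossing ends E U π) x
  · obtain ⟨x, hx, hdx⟩ := hB
    refine ((ih _ (erase_ssubset hx)).of_erase hx).mono ?_
    have h1 : U.image π ⊆ insert (π x) ((U.erase x).image π) := by
      rw [← image_insert, insert_erase hx]
    have h2 := herase x hx
    have h3 := (card_le_card h1).trans (card_insert_le _ _)
    omega
  by_cases hC : ∃ x ∈ U, ∃ y ∈ U, y ≠ x ∧ π y = π x
  · obtain ⟨x, hx, y, hy, hyx, hπ⟩ := hC
    set C := U.filter fun z => π z = π x with hC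
    have hxC : x ∈ C := mem_filter.2 ⟨hx, rfl⟩
    have hCU : C ⊆ U := filter_subset _ _
    have hcl : ∀ e ∈ inside ends E U, (∃ z ∈ ends e, z ∈ C) → ∀ z ∈ ends e, z ∈ C ∪ ∅ := by
      rintro e he ⟨z, hz, hzC⟩ w hw
      rw [union_empty]
      rw [hC, mem_filter] at hzC ⊢
      refine ⟨(mem_inside.1 he).2 w hw, ?_⟩
      by_contra hne
      refine hA ⟨z, hzC.1, ?_, card_pos.2 ⟨e, mem_filter.2 ⟨mem_crossing.2
        ⟨inside_subset he, (mem_inside.1 he).2, w, hw, z, hz, by rwa [hzC.2]⟩, hz⟩⟩⟩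
      by_cases hzx : z = x
      · exact ⟨y, hy, hzx ▸ hyx, by rw [hπ, hzC.2]⟩
      · exact ⟨x, hx, Ne.symm hzx, hzC.2.symm⟩
    have h0 := ih (U \ (C ∪ ∅)) (sdiff_ssubset (by simpa using hCU) (by simp; exact ⟨x, hxC⟩))
    refine (h0.of_sdiff ⟨x, hxC⟩ hCU (empty_subset _) (disjoint_empty_right _) hcl).mono ?_
    rw [union_empty]
    have h1 : U.image π ⊆ insert (π x) ((U \ C).image π) := by
      intro i hi
      obtain ⟨z, hz, rfl⟩ := mem_image.1 hi
      by_cases hzx : π z = π x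
      · simp [hzx]
      · exact mem_insert_of_mem (mem_image_of_mem _ (by simp [hC, hz, hzx]))
    have h2 := card_le_card (crossing_mono (ends := ends) (F := E) π subset_rfl
      (sdiff_subset : U \ C ⊆ U))
    have h3 := (card_le_card h1).trans (card_insert_le _ _)
    simp
    omega
  · have hinj : Set.InjOn π U := by
      intro x hx y hy hxy
      by_contra hne
      exact hC ⟨y, hy, x, hx, hne, hxy⟩
    have hcr : crossing ends E U π = inside ends E U := by
      refine filter_true_of_mem fun e he => ?_
      rw [mem_inside] at he
      have hdg := hl e he.1
      induction hz : ends e with | _ a b =>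
      rw [hz, Sym2.mk_isDiag_iff] at hdg
      exact ⟨a, by simp, b, by simp, fun h => hdg (hinj (he.2 a (by simp [hz]))
        (he.2 b (by simp [hz])) h)⟩
    rw [card_image_of_injOn hinj, hcr]
    refine (splits_of_deg_le_two hl U fun v hv => ?_).mono (by split_ifs <;> omega)
    rw [← hcr]
    by_contra h
    exact hB ⟨v, hv, by omega⟩

/-! ### Tight spanning sets from partition counts -/

variable [DecidableEq ι]

/-- In a maximal sparse set every unused edge is spanned by a tight set, so it does not cross the
partition into maximal tight sets. The hypothesis for this one partition then forces 2(|V| - 1)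
edges. -/
theorem exists_sparse_tight_of_le_crossing {E : Finset β} {V : Finset α} (hV : V.Nonempty)
    (hEV : ∀ e ∈ E, ∀ x ∈ ends e, x ∈ V)
    (h : ∀ π : α → Finset α, 2 * #(V.image π) ≤ #(crossing ends E V π) + 2) :
    ∃ H ⊆ E, Sparse ends H ∧ Tight ends H V := by
  have h0 : Sparse ends (∅ : Finset β) := by
    intro X hX
    have := hX.card_pos
    simp [inside]
    omega
  obtain ⟨H, hHm, hmax⟩ := exists_max_image (E.powerset.filter fun H => Sparse ends H) card
    ⟨∅, by simp [h0]⟩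
  simp only [mem_filter, mem_powerset] at hHm hmax
  obtain ⟨hHE, hH⟩ := hHm
  have hHV : ∀ e ∈ H, ∀ x ∈ ends e, x ∈ V := fun e he => hEV e (hHE he)
  obtain ⟨π, hπ, hcount⟩ := hH.exists_partition V
  have hcr : crossing ends E V π = crossing ends H V π := by
    refine crossing_eq_of_subset hHE fun e heE heH _ => ?_
    have hn : ¬ Sparse ends (insert e H) := fun hs => by
      have := hmax (insert e H) ⟨insert_subset heE hHE, hs⟩
      rw [card_insert_of_notMem heH] at this
      omega
    obtain ⟨X, hX, hi⟩ := hH.exists_tight_of_not_insert hn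
    have hXV : (X ∩ V).Nonempty :=
      ⟨_, mem_inter.2 ⟨hi _ (Sym2.out_fst_mem _), hEV e heE _ (Sym2.out_fst_mem _)⟩⟩
    have h1 := hH _ hXV
    rw [inside_inter, inside_eq_self hHV, inter_eq_left.2 inside_subset] at h1
    have h2 : X ∩ V = X := eq_of_subset_of_card_le inter_subset_left (by have := hX.2; omega)
    exact fun x hx y hy => hπ X (inter_eq_left.1 h2) hX x (hi x hx) y (hi y hy)
  refine ⟨H, hHE, hH, hV, ?_⟩
  have h1 := h π
  have h2 := hH V hV
  rw [hcr] at h1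
  omega

/-- Contracting the classes leaves a connected multigraph. Starting from one class and adding
neighbouring classes in turn, each addition uses a new crossing edge. -/
theorem Connects.card_image_le {T : Finset β} {V : Finset α} (hT : Connects ends T V)
    (hTV : ∀ e ∈ T, ∀ x ∈ ends e, x ∈ V) (π : α → ι) :
    #(V.image π) ≤ #(crossing ends T V π) + 1 := by
  have key : ∀ k, k + 1 ≤ #(V.image π) → ∃ B ⊆ V.image π, #B = k + 1 ∧
      k ≤ #((crossing ends T V π).filter fun e => ∀ x ∈ ends e, π x ∈ B) := by
    intro k
    induction k with
    | zero =>
      intro h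
      obtain ⟨i, hi⟩ := card_pos.1 h
      exact ⟨{i}, by simpa using hi, by simp, Nat.zero_le _⟩
    | succ k ih =>
      intro h
      obtain ⟨B, hB, hBc, hBk⟩ := ih (by omega)
      obtain ⟨i, hi⟩ := card_pos.1 (show 0 < #B by omega)
      obtain ⟨x, hx, rfl⟩ := mem_image.1 (hB hi)
      obtain ⟨j, hj, hjB⟩ : ∃ j ∈ V.image π, j ∉ B := by
        by_contra! hc
        have := card_le_card (show V.image π ⊆ B from hc)
        omega
      obtain ⟨y, hy, rfl⟩ := mem_image.1 hj
      obtain ⟨e, he, p, q, hpq, hp, hq⟩ := hT (V.filter (π · ∈ B)) ⟨x, hx, by simp [hx, hi]⟩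
        ⟨y, hy, by simp [hjB]⟩
      have hqV : q ∈ V := hTV e he q (by simp [hpq])
      have hqB : π q ∉ B := fun h => hq (mem_filter.2 ⟨hqV, h⟩)
      have hpB := (mem_filter.1 hp).2
      refine ⟨insert (π q) B, insert_subset (mem_image_of_mem _ hqV) hB, ?_, ?_⟩
      · rw [card_insert_of_notMem hqB, hBc]
      · have h1 : e ∉ (crossing ends T V π).filter fun e => ∀ x ∈ ends e, π x ∈ B := fun h =>
          hqB ((mem_filter.1 h).2 q (by simp [hpq]))
        have h2 : insert e ((crossing ends T V π).filter fun e => ∀ x ∈ ends e, π x ∈ B) ⊆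
            (crossing ends T V π).filter fun e => ∀ x ∈ ends e, π x ∈ insert (π q) B := by
          refine insert_subset (mem_filter.2 ⟨mem_crossing.2 ⟨he, hTV e he, p, by simp [hpq], q,
            by simp [hpq], fun h => hqB (h ▸ hpB)⟩, ?_⟩) fun f hf => ?_
          · simp [hpq, hpB]
          · rw [mem_filter] at hf ⊢
            exact ⟨hf.1, fun x hx => mem_insert_of_mem (hf.2 x hx)⟩
        have h3 := card_le_card h2
        rw [card_insert_of_notMem h1] at h3
        omega
  by_contra hlt
  obtain ⟨B, -, -, h⟩ := key (#(crossing ends T V π) + 1) (by omega)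
  have := card_filter_le (crossing ends T V π) fun e => ∀ x ∈ ends e, π x ∈ B
  omega

theorem exists_sparse_tight_of_connects {E T₁ T₂ : Finset β} {V : Finset α} (hV : V.Nonempty)
    (hEV : ∀ e ∈ E, ∀ x ∈ ends e, x ∈ V) (h₁ : T₁ ⊆ E) (h₂ : T₂ ⊆ E) (hd : Disjoint T₁ T₂)
    (hc₁ : Connects ends T₁ V) (hc₂ : Connects ends T₂ V) :
    ∃ H ⊆ E, Sparse ends H ∧ Tight ends H V := by
  refine exists_sparse_tight_of_le_crossing hV hEV fun π => ?_
  have h3 := hc₁.card_image_le (fun e he => hEV e (h₁ he)) π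
  have h4 := hc₂.card_image_le (fun e he => hEV e (h₂ he)) π
  have h5 : Disjoint (crossing ends T₁ V π) (crossing ends T₂ V π) :=
    hd.mono ((filter_subset _ _).trans inside_subset) ((filter_subset _ _).trans inside_subset)
  have h6 := card_le_card (union_subset (crossing_mono (ends := ends) (U := V) π h₁ subset_rfl)
    (crossing_mono (ends := ends) (U := V) π h₂ subset_rfl))
  rw [card_union_of_disjoint h5] at h6
  omega

/-! ### The degree theorem for sparse tight sets -/

/-- `k` is at most the number of components of the multigraph induced by `U`: the vertices of `U`
can be coloured with `k` colours such that every edge inside `U` is monochromatic. -/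
def HasColoring (ends : β → Sym2 α) (E : Finset β) (U : Finset α) (k : ℕ) : Prop :=
  ∃ c : α → α, (∀ e ∈ inside ends E U, ∀ x ∈ ends e, ∀ y ∈ ends e, c x = c y) ∧ #(U.image c) = k

theorem exists_connects_deg_two_four {E H₀ : Finset β} {V : Finset α} (hV : 2 ≤ #V)
    (hEV : ∀ e ∈ E, ∀ x ∈ ends e, x ∈ V) (hl : ∀ e ∈ E, ¬ (ends e).IsDiag)
    (hH₀E : H₀ ⊆ E) (hH₀ : Sparse ends H₀) (hH₀V : Tight ends H₀ V)
    (hω : ∀ W ⊆ V, ∀ k, HasColoring ends E (V \ W) k → 7 * k ≤ 2 * #W + 9) :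
    ∃ J ⊆ E, Connects ends J V ∧ ∀ v ∈ V, deg ends J v = 2 ∨ deg ends J v = 4 := by
  obtain ⟨H, hHE, hH, hHV, hdeg | ⟨S, hSV, hS5, ⟨w, hwS, hw⟩, hS⟩⟩ :=
    exists_deg_le_five_or_obstruction hH₀E hH₀ hH₀V
  · obtain ⟨J, hJH, hJ, heven⟩ := hHV.exists_connects_even hH fun e he => hEV e (hHE he)
    refine ⟨J, hJH.trans hHE, hJ, fun v hv => ?_⟩
    have h1 := (deg_mono (ends := ends) hJH v).trans (hdeg v hv)
    obtain ⟨u, hu, huv⟩ := exists_mem_ne (by omega : 1 < #V) v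
    obtain ⟨e, he, x, y, hxy, hx, -⟩ := hJ {v} ⟨v, hv, by simp⟩ ⟨u, hu, by simpa using huv⟩
    have h2 : 0 < deg ends J v := card_pos.2 ⟨e, mem_filter.2 ⟨he, by
      rw [mem_singleton] at hx; simp [hxy, hx]⟩⟩
    obtain ⟨m, hm⟩ := heven v hv
    omega
  · exfalso
    have hHEV : ∀ e ∈ H, ∀ x ∈ ends e, x ∈ V := fun e he => hEV e (hHE he)
    obtain ⟨π, hπ, hcount⟩ := hH.exists_partition (V \ S)
    have hcr : crossing ends E (V \ S) π = crossing ends H (V \ S) π := by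
      refine crossing_eq_of_subset hHE fun e heE heH heU => ?_
      obtain ⟨X, hXU, hX, hi⟩ := hS e heE heH heU
      exact fun x hx y hy => hπ X hXU hX x (hi x hx) y (hi y hy)
    obtain ⟨W, hW, c, -, hc, hk⟩ := splits_of_partition hl (V \ S) π
    have h1 := hω (W ∪ S) (union_subset (hW.trans sdiff_subset) hSV) _ ⟨c, by
      rw [show V \ (W ∪ S) = (V \ S) \ W by
        ext x; simp only [mem_sdiff, mem_union]; tauto]
      exact hc, rfl⟩
    -- Since the degree sum over `S` is at least 5|S| + 1, `H` has 2|V| - 2 edges and `S` spans at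
    -- most 2|S| - 2 of them, at most 2|V| - 3|S| - 5 edges of `H` avoid `S`. Together with `hcount`
    -- this gives 4p - 2q ≥ 2|S| + 10, one unit more than the hypothesis permits.
    have h2 := sum_deg_add_card_inside (S := S) hHEV fun e he => hH.not_isDiag he
    have h3 : ∑ v ∈ S, 5 < ∑ v ∈ S, deg ends H v := sum_lt_sum hS5 ⟨w, hwS, hw⟩
    have h4 := hH S ⟨w, hwS⟩
    have h5 := hHV.2
    rw [inside_eq_self hHEV] at h5
    have h6 := card_sdiff_add_card_eq_card hSV
    have h7 := card_union_le W S
    rw [sum_const, smul_eq_mul] at h3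
    have h8 : V \ (W ∪ S) = (V \ S) \ W := by
      ext x; simp only [mem_sdiff, mem_union]; tauto
    rw [h8] at h1
    rw [hcr] at hk
    omega

/-! ### Tough graphs -/

/-- With at most three edges in the cut, a side with four or more vertices could be separated from
the other by deleting the at most three ends on that side. So both sides have at most three
vertices. Then deleting all but one vertex on each side removes at most four vertices, so every such
pair is adjacent, and |X||V \ X| ≥ |V| - 1. -/
theorem card_edges_between_ge {E : Finset β} {V X : Finset α}
    (hEV : ∀ e ∈ E, ∀ x ∈ ends e, x ∈ V)
    (hω : ∀ W ⊆ V, ∀ k, HasColoring ends E (V \ W) k → 7 * k ≤ max 7 (2 * #W))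
    (hX : X.Nonempty) (hXV : X ⊂ V) :
    min 4 (#V - 1) ≤ #(E.filter fun e => (∃ x ∈ ends e, x ∈ X) ∧ ∃ y ∈ ends e, y ∉ X) := by
  set D := E.filter fun e => (∃ x ∈ ends e, x ∈ X) ∧ ∃ y ∈ ends e, y ∉ X with hD
  by_contra hlt
  have hD3 : #D ≤ 3 := by omega
  have hends : ∀ e ∈ D, ∃ x y, ends e = s(x, y) ∧ x ∈ X ∧ y ∈ V ∧ y ∉ X := by
    intro e he
    obtain ⟨heE, ⟨x, hx, hxX⟩, y, hy, hyX⟩ := mem_filter.1 he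
    have hne : x ≠ y := by rintro rfl; exact hyX hxX
    exact ⟨x, y, (Sym2.mem_and_mem_iff hne).1 ⟨hx, hy⟩, hxX, hEV e heE y hy, hyX⟩
  obtain ⟨a₀, ha₀⟩ := hX
  obtain ⟨b₀, hb₀V, hb₀⟩ := exists_of_ssubset hXV
  have : Nonempty α := ⟨a₀⟩
  choose! p q hpq hp hqV hq using hends
  have hDmem : ∀ e ∈ E, ∀ x ∈ ends e, ∀ y ∈ ends e, x ∈ X → y ∉ X → e ∈ D ∧ x = p e ∧ y = q e := by
    intro e he x hx y hy hxX hyX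
    have heD : e ∈ D := mem_filter.2 ⟨he, ⟨x, hx, hxX⟩, y, hy, hyX⟩
    refine ⟨heD, ?_⟩
    rw [hpq e heD, Sym2.mem_iff] at hx hy
    refine ⟨hx.resolve_right ?_, hy.resolve_left ?_⟩
    · rintro rfl; exact hq e heD hxX
    · rintro rfl; exact hyX (hp e heD)
  -- Two components would require 14 ≤ 2|W|, hence at least seven deleted vertices.
  have htwo : ∀ W ⊆ V, #W ≤ 6 → ∀ a ∈ V \ W, ∀ b ∈ V \ W, a ∈ X → b ∉ X →
      ∃ e ∈ E, (∀ x ∈ ends e, x ∈ V \ W) ∧ e ∈ D := by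
    intro W hWV hW6 a ha b hb haX hbX
    by_contra! hcon
    have h1 := hω W hWV _ ⟨fun v => if v ∈ X then a else b, fun e he x hx y hy => ?_, rfl⟩
    · have h2 : {a, b} ⊆ (V \ W).image fun v => if v ∈ X then a else b := by
        refine insert_subset (mem_image.2 ⟨a, ha, if_pos haX⟩) (singleton_subset_iff.2 ?_)
        exact mem_image.2 ⟨b, hb, if_neg hbX⟩
      have h3 := card_le_card h2
      rw [card_pair (by rintro rfl; exact hbX haX)] at h3
      omega
    · rw [mem_inside] at he
      by_cases hxX : x ∈ X <;> by_cases hyX : y ∈ X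
      · simp [hxX, hyX]
      · exact absurd (hDmem e he.1 x hx y hy hxX hyX).1 (hcon e he.1 he.2)
      · exact absurd (hDmem e he.1 y hy x hx hyX hxX).1 (hcon e he.1 he.2)
      · simp [hxX, hyX]
  have hX3 : #X ≤ 3 := by
    by_contra hgt
    have h1 : #(D.image p) ≤ 3 := card_image_le.trans hD3
    obtain ⟨a, haX, ha⟩ := exists_mem_notMem_of_card_lt_card (show #(D.image p) < #X by omega)
    have hpX : ∀ x ∈ D.image p, x ∈ X := fun x hx => by
      obtain ⟨e, he, rfl⟩ := mem_image.1 hx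
      exact hp e he
    obtain ⟨e, -, he, heD⟩ := htwo (D.image p) (fun x hx => hXV.1 (hpX x hx)) (by omega) a
      (mem_sdiff.2 ⟨hXV.1 haX, ha⟩) b₀ (mem_sdiff.2 ⟨hb₀V, fun h => hb₀ (hpX _ h)⟩) haX hb₀
    exact (mem_sdiff.1 (he (p e) (by simp [hpq e heD]))).2 (mem_image_of_mem _ heD)
  have hY3 : #(V \ X) ≤ 3 := by
    by_contra hgt
    have h1 : #(D.image q) ≤ 3 := card_image_le.trans hD3
    obtain ⟨b, hbX, hb⟩ := exists_mem_notMem_of_card_lt_card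
      (show #(D.image q) < #(V \ X) by omega)
    rw [mem_sdiff] at hbX
    have hqX : ∀ x ∈ D.image q, x ∈ V ∧ x ∉ X := fun x hx => by
      obtain ⟨e, he, rfl⟩ := mem_image.1 hx
      exact ⟨hqV e he, hq e he⟩
    obtain ⟨e, -, he, heD⟩ := htwo (D.image q) (fun x hx => (hqX x hx).1) (by omega) a₀
      (mem_sdiff.2 ⟨hXV.1 ha₀, fun h => (hqX _ h).2 ha₀⟩) b (mem_sdiff.2 ⟨hbX.1, hb⟩) ha₀ hbX.2
    exact (mem_sdiff.1 (he (q e) (by simp [hpq e heD]))).2 (mem_image_of_mem _ heD)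
  have hVX := card_sdiff_add_card_eq_card hXV.1
  have hprod : X ×ˢ (V \ X) ⊆ D.image fun e => (p e, q e) := by
    rintro ⟨a, b⟩ hab
    simp only [mem_product, mem_sdiff] at hab
    obtain ⟨haX, hbV, hbX⟩ := hab
    have hVab : V \ (V \ {a, b}) = {a, b} := by
      rw [sdiff_sdiff_right_self]
      exact inter_eq_right.2 (by simp [insert_subset_iff, hXV.1 haX, hbV])
    obtain ⟨e, heE, he, heD⟩ := htwo (V \ {a, b}) sdiff_subset
      ((card_le_card sdiff_subset).trans (by omega)) a (by rw [hVab]; simp) b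
      (by rw [hVab]; simp) haX hbX
    rw [hVab] at he
    have h1 := he (p e) (by simp [hpq e heD])
    have h2 := he (q e) (by simp [hpq e heD])
    have h3 := hp e heD
    have h4 := hq e heD
    simp only [mem_insert, mem_singleton] at h1 h2
    refine mem_image.2 ⟨e, heD, Prod.ext ?_ ?_⟩
    · exact h1.resolve_right fun h => hbX (h ▸ h3)
    · exact h2.resolve_left fun h => h4 (h.symm ▸ haX)
  have h1 := (card_le_card hprod).trans card_image_le
  rw [card_product] at h1
  have h2 : 0 < #X := card_pos.2 ⟨a₀, ha₀⟩
  have h3 : 0 < #(V \ X) := card_pos.2 ⟨b₀, mem_sdiff.2 ⟨hb₀V, hb₀⟩⟩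
  have h4 : #X + #(V \ X) ≤ #X * #(V \ X) + 1 := by
    obtain ⟨i, hi⟩ := Nat.exists_eq_add_of_lt h2
    obtain ⟨j, hj⟩ := Nat.exists_eq_add_of_lt h3
    rw [hi, hj]
    ring_nf
    omega
  omega

/-- Summing degrees after contracting the classes gives 4p ≤ 2q if |V| ≥ 5, for p classes and q
crossing edges. If |V| = 4, it gives 3p ≤ 2q, which suffices because p ≤ 4. -/
theorem two_mul_card_image_le_of_tough {E : Finset β} {V : Finset α} (hV : 4 ≤ #V)
    (hEV : ∀ e ∈ E, ∀ x ∈ ends e, x ∈ V)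
    (hω : ∀ W ⊆ V, ∀ k, HasColoring ends E (V \ W) k → 7 * k ≤ max 7 (2 * #W)) (π : α → ι) :
    2 * #(V.image π) ≤ #(crossing ends E V π) + 2 := by
  rcases Nat.lt_or_ge #(V.image π) 2 with hp | hp
  · omega
  set D := crossing ends E V π with hD
  have hdeg : ∀ i ∈ V.image π, min 4 (#V - 1) ≤ deg (fun e => (ends e).map π) D i := by
    intro i hi
    obtain ⟨v, hv, rfl⟩ := mem_image.1 hi
    obtain ⟨j, hj, hji⟩ := exists_mem_ne (by omega : 1 < #(V.image π)) (π v)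
    obtain ⟨w, hw, rfl⟩ := mem_image.1 hj
    refine (card_edges_between_ge (X := V.filter (π · = π v)) hEV hω ⟨v, by simp [hv]⟩
      ((ssubset_iff_of_subset (filter_subset _ _)).2 ⟨w, hw, by simp [hji]⟩)).trans ?_
    refine card_le_deg fun e he => ?_
    obtain ⟨heE, ⟨x, hx, hxX⟩, y, hy, hyX⟩ := mem_filter.1 he
    rw [mem_filter] at hxX hyX
    refine ⟨mem_crossing.2 ⟨heE, hEV e heE, x, hx, y, hy, fun h => ?_⟩,
      Sym2.mem_map.2 ⟨x, hx, hxX.2⟩⟩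
    exact hyX ⟨hEV e heE y hy, h ▸ hxX.2⟩
  have h1 := sum_deg_add_card_inside (ends := fun e => (ends e).map π) (F := D) (V := V.image π)
    (S := V.image π) (fun e he i hi => by
      obtain ⟨x, hx, rfl⟩ := Sym2.mem_map.1 hi
      exact mem_image_of_mem _ ((mem_crossing.1 he).2.1 x hx)) (fun e he => by
      obtain ⟨-, -, x, hx, y, hy, hxy⟩ := mem_crossing.1 he
      have hne : x ≠ y := by rintro rfl; exact hxy rfl
      rw [(Sym2.mem_and_mem_iff hne).1 ⟨hx, hy⟩, Sym2.map_mk, Sym2.mk_isDiag_iff]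
      exact hxy)
  have h2 := card_nsmul_le_sum (V.image π)
    (fun i => deg (fun e => (ends e).map π) D i) _ hdeg
  have h3 : #(inside (fun e => (ends e).map π) D (V.image π)) ≤ #D := card_le_card inside_subset
  have h4 : #(V.image π) ≤ #V := card_image_le
  rw [smul_eq_mul] at h2
  rcases Nat.lt_or_ge #V 5 with h5 | h5
  · rw [show min 4 (#V - 1) = 3 by omega] at h2
    omega
  · rw [show min 4 (#V - 1) = 4 by omega] at h2
    omega

/-- Order three needs separate treatment, since a triangle has too few edges for two disjoint
spanning trees. Any two vertices are adjacent, as deleting the third must not disconnect them. -/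
theorem exists_triangle {E : Finset β} {V : Finset α} (hV : #V = 3)
    (hω : ∀ W ⊆ V, ∀ k, HasColoring ends E (V \ W) k → 7 * k ≤ max 7 (2 * #W)) :
    ∃ J ⊆ E, Connects ends J V ∧ ∀ v ∈ V, deg ends J v = 2 ∨ deg ends J v = 4 := by
  have hedge : ∀ a ∈ V, ∀ b ∈ V, a ≠ b → ∃ e ∈ E, ends e = s(a, b) := by
    intro a ha b hb hab
    by_contra! hcon
    have hVab : V \ (V \ {a, b}) = {a, b} := by
      rw [sdiff_sdiff_right_self]
      exact inter_eq_right.2 (by simp [insert_subset_iff, ha, hb])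
    have h1 := hω (V \ {a, b}) sdiff_subset 2 ⟨id, ?_, by rw [hVab, image_id, card_pair hab]⟩
    · have := card_le_card (sdiff_subset : V \ {a, b} ⊆ V)
      omega
    · intro e he x hx y hy
      rw [hVab, mem_inside] at he
      by_contra hxy
      have h2 := (Sym2.mem_and_mem_iff hxy).1 ⟨hx, hy⟩
      have h3 := he.2 x hx
      have h4 := he.2 y hy
      simp only [mem_insert, mem_singleton, id_eq] at h3 h4 hxy
      rcases h3 with rfl | rfl <;> rcases h4 with rfl | rfl
      · exact hxy rfl
      · exact hcon e he.1 h2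
      · exact hcon e he.1 (h2.trans Sym2.eq_swap)
      · exact hxy rfl
  obtain ⟨a, b, c, hab, hac, hbc, rfl⟩ := card_eq_three.1 hV
  obtain ⟨e, heE, he⟩ := hedge a (by simp) b (by simp) hab
  obtain ⟨f, hfE, hf⟩ := hedge a (by simp) c (by simp) hac
  obtain ⟨g, hgE, hg⟩ := hedge b (by simp) c (by simp) hbc
  have hef : e ≠ f := by rintro rfl; rw [he, Sym2.eq_iff] at hf; grind
  have heg : e ≠ g := by rintro rfl; rw [he, Sym2.eq_iff] at hg; grind
  have hfg : f ≠ g := by rintro rfl; rw [hf, Sym2.eq_iff] at hg; grind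
  refine ⟨{e, f, g}, by simp [insert_subset_iff, heE, hfE, hgE], ?_, ?_⟩
  · have hpair : ∀ A : Finset α, ∀ k ∈ ({e, f, g} : Finset β), ∀ x y, ends k = s(x, y) →
        ¬ (x ∈ A ↔ y ∈ A) →
        ∃ k ∈ ({e, f, g} : Finset β), ∃ x y, ends k = s(x, y) ∧ x ∈ A ∧ y ∉ A := by
      intro A k hk x y hxy hA
      by_cases hx : x ∈ A
      · exact ⟨k, hk, x, y, hxy, hx, by tauto⟩
      · exact ⟨k, hk, y, x, hxy.trans Sym2.eq_swap, by tauto, hx⟩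
    rintro A ⟨x, hx, hxA⟩ ⟨y, hy, hyA⟩
    by_cases h1 : a ∈ A ↔ b ∈ A
    · by_cases h2 : a ∈ A ↔ c ∈ A
      · simp only [mem_insert, mem_singleton] at hx hy
        rcases hx with rfl | rfl | rfl <;> rcases hy with rfl | rfl | rfl <;> tauto
      · exact hpair A f (by simp) a c hf h2
    · exact hpair A e (by simp) a b he h1
  · intro v hv
    left
    simp only [mem_insert, mem_singleton] at hv
    unfold deg
    rcases hv with rfl | rfl | rfl
    · rw [card_eq_two]
      exact ⟨e, f, hef, by ext k; simp; grind⟩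
    · rw [card_eq_two]
      exact ⟨e, g, heg, by ext k; simp; grind⟩
    · rw [card_eq_two]
      exact ⟨f, g, hfg, by ext k; simp; grind⟩

theorem exists_connects_deg_two_four_of_tough {E : Finset β} {V : Finset α} (hV : 3 ≤ #V)
    (hEV : ∀ e ∈ E, ∀ x ∈ ends e, x ∈ V) (hl : ∀ e ∈ E, ¬ (ends e).IsDiag)
    (hω : ∀ W ⊆ V, ∀ k, HasColoring ends E (V \ W) k → 7 * k ≤ max 7 (2 * #W)) :
    ∃ J ⊆ E, Connects ends J V ∧ ∀ v ∈ V, deg ends J v = 2 ∨ deg ends J v = 4 := by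
  rcases hV.eq_or_lt with h3 | h4
  · exact exists_triangle h3.symm hω
  · obtain ⟨H, hHE, hH, hHV⟩ := exists_sparse_tight_of_le_crossing (card_pos.1 (by omega)) hEV
      (two_mul_card_image_le_of_tough h4 hEV hω)
    exact exists_connects_deg_two_four (by omega) hEV hl hHE hH hHV fun W hW k hk => by
      have := hω W hW k hk
      omega

end Multigraph

/-! ### Transfer to `Graph` -/

namespace Graph

open Multigraph

variable {α β : Type*} {G : Graph α β} {ends : β → Sym2 α} {V : Finset α} {E : Finset β}

theorem exists_ends [Nonempty α] (G : Graph α β) :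
    ∃ ends : β → Sym2 α, ∀ e ∈ G.edgeSet, ∀ x y, G.IsLink e x y ↔ ends e = s(x, y) := by
  have h : ∀ e ∈ G.edgeSet, ∃ z : Sym2 α, ∀ x y, G.IsLink e x y ↔ z = s(x, y) := by
    intro e he
    obtain ⟨x, y, hxy⟩ := exists_isLink_of_mem_edgeSet he
    exact ⟨s(x, y), fun _ _ => hxy.isLink_iff_sym2_eq⟩
  have : Nonempty (Sym2 α) := ⟨s(Classical.arbitrary α, Classical.arbitrary α)⟩
  choose! ends hends using h
  exact ⟨ends, hends⟩

/-- Colours are constant along walks, so components map onto colours. -/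
theorem le_numComponents_of_hasColoring (hV : (V : Set α) = G.vertexSet)
    (hE : (E : Set β) = G.edgeSet)
    (hends : ∀ e ∈ G.edgeSet, ∀ x y, G.IsLink e x y ↔ ends e = s(x, y)) {W : Finset α} {k : ℕ}
    (h : HasColoring ends E (V \ W) k) : k ≤ (G.deleteVerts (W : Set α)).numComponents := by
  obtain ⟨c, hc, rfl⟩ := h
  set K := G.deleteVerts (W : Set α) with hK
  have hKV : ∀ v, v ∈ K.vertexSet ↔ v ∈ V \ W := by
    intro v
    rw [hK, vertexSet_deleteVerts, ← hV, mem_sdiff]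
    rfl
  have : Finite K.vertexSet := Set.Finite.subset (V \ W).finite_toSet fun v hv => (hKV v).1 hv
  have hadj : ∀ u v : K.vertexSet, K.toSimpleGraph.Adj u v → c u = c v := by
    rintro u v ⟨-, e, he⟩
    have huv := (deleteVerts_isLink G (W : Set α)).1 he
    have he' := (hends e huv.1.edge_mem _ _).1 huv.1
    refine hc e (mem_inside.2 ⟨?_, ?_⟩) u (by simp [he']) v (by simp [he'])
    · have := huv.1.edge_mem
      rwa [← hE] at this
    · rw [he']
      intro x hx
      rcases Sym2.mem_iff.1 hx with rfl | rfl
      exacts [(hKV _).1 u.2, (hKV _).1 v.2]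
  have hwalk : ∀ u v : K.vertexSet, K.toSimpleGraph.Walk u v → c u = c v := by
    intro u v p
    induction p with
    | nil => rfl
    | cons h _ ih => exact (hadj _ _ h).trans ih
  let f : K.toSimpleGraph.ConnectedComponent → (V \ W).image c := fun C =>
    C.lift (fun v : K.vertexSet => (⟨c v, mem_image_of_mem c ((hKV _).1 v.2)⟩ : (V \ W).image c))
      fun v w p _ => Subtype.ext (hwalk v w p)
  have hf : Function.Surjective f := by
    rintro ⟨i, hi⟩
    obtain ⟨v, hv, rfl⟩ := mem_image.1 hi
    exact ⟨K.toSimpleGraph.connectedComponentMk ⟨v, (hKV v).2 hv⟩, rfl⟩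
  have := Nat.card_le_card_of_surjective f hf
  rwa [Nat.card_eq_fintype_card, Fintype.card_coe] at this

theorem isConnected_restrict (hV : (V : Set α) = G.vertexSet) (hne : V.Nonempty)
    (hends : ∀ e ∈ G.edgeSet, ∀ x y, G.IsLink e x y ↔ ends e = s(x, y)) {J : Finset β}
    (hJ : (J : Set β) ⊆ G.edgeSet) (hc : Connects ends J V) :
    (G.restrict (J : Set β)).IsConnected := by
  have hmem : ∀ v, v ∈ (G.restrict (J : Set β)).vertexSet ↔ v ∈ V := by
    intro v
    rw [vertexSet_restrict, ← hV]
    rfl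
  obtain ⟨r, hr⟩ := hne
  have : Nonempty (G.restrict (J : Set β)).vertexSet := ⟨⟨r, (hmem r).2 hr⟩⟩
  refine ⟨fun u v => ?_⟩
  by_contra hn
  set R : α → Prop := fun x => ∃ hx : x ∈ (G.restrict (J : Set β)).vertexSet,
    (G.restrict (J : Set β)).toSimpleGraph.Reachable u ⟨x, hx⟩
  have hu : R u := ⟨u.2, .refl _⟩
  have hv : ¬ R v := fun ⟨_, h⟩ => hn h
  obtain ⟨e, he, x, y, hxy, hx, hy⟩ := hc (V.filter R)
    ⟨u, (hmem u).1 u.2, mem_filter.2 ⟨(hmem u).1 u.2, hu⟩⟩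
    ⟨v, (hmem v).1 v.2, fun h => hv (mem_filter.1 h).2⟩
  obtain ⟨hxV, hxR⟩ := (mem_filter.1 hx).2
  have hlink := (hends e (hJ he) x y).2 hxy
  have hyV : y ∈ (G.restrict (J : Set β)).vertexSet := hlink.right_mem
  refine hy (mem_filter.2 ⟨(hmem y).1 hyV, hyV, hxR.trans (SimpleGraph.Adj.reachable ?_)⟩)
  refine ⟨?_, e, he, hlink⟩
  rintro h
  rw [Subtype.mk.injEq] at h
  exact hy (h ▸ hx)

theorem degree_restrict (hends : ∀ e ∈ G.edgeSet, ∀ x y, G.IsLink e x y ↔ ends e = s(x, y))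
    {J : Finset β} (hJ : (J : Set β) ⊆ G.edgeSet) (v : α) :
    (G.restrict (J : Set β)).degree v = deg ends J v := by
  rw [degree, deg, ← Set.ncard_coe_finset]
  congr 1
  ext e
  simp only [mem_incidenceSet, restrict_inc, mem_coe, mem_filter]
  constructor
  · rintro ⟨⟨w, hw⟩, he⟩
    exact ⟨he, by simp [(hends e (hJ he) v w).1 hw]⟩
  · rintro ⟨he, w, hw⟩
    exact ⟨⟨w, (hends e (hJ he) v w).2 hw⟩, he⟩

theorem IsConnected.connects (hV : (V : Set α) = G.vertexSet) (hE : (E : Set β) = G.edgeSet)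
    (hends : ∀ e ∈ G.edgeSet, ∀ x y, G.IsLink e x y ↔ ends e = s(x, y)) {T : Graph α β}
    (hT : T ≤s G) (hc : T.IsConnected) : Connects ends (E.filter (· ∈ T.edgeSet)) V := by
  have hmem : ∀ v, v ∈ T.vertexSet ↔ v ∈ V := by
    intro v
    rw [hT.vertexSet_eq, ← hV]
    rfl
  rintro A ⟨x, hxV, hx⟩ ⟨y, hyV, hy⟩
  obtain ⟨p⟩ := hc.preconnected ⟨x, (hmem x).2 hxV⟩ ⟨y, (hmem y).2 hyV⟩
  obtain ⟨d, -, hd1, hd2⟩ := p.exists_boundary_dart {v | (v : α) ∈ A} hx hy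
  obtain ⟨-, e, he⟩ := d.adj
  have heG := he.mono hT.le
  have heE := heG.edge_mem
  refine ⟨e, mem_filter.2 ⟨?_, he.edge_mem⟩, _, _, (hends e heE _ _).1 heG, hd1, hd2⟩
  rwa [← hE] at heE

theorem exists_factor_of_connects (hV : (V : Set α) = G.vertexSet) (hne : V.Nonempty)
    (hE : (E : Set β) = G.edgeSet)
    (hends : ∀ e ∈ G.edgeSet, ∀ x y, G.IsLink e x y ↔ ends e = s(x, y))
    (h : ∃ J ⊆ E, Connects ends J V ∧ ∀ v ∈ V, deg ends J v = 2 ∨ deg ends J v = 4) :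
    ∃ H : Graph α β, H.IsFactor G {2, 4} ∧ H.IsConnected := by
  obtain ⟨J, hJE, hJ, hdeg⟩ := h
  have hJG : (J : Set β) ⊆ G.edgeSet := hE ▸ coe_subset.2 hJE
  refine ⟨G.restrict (J : Set β), ⟨⟨restrict_le, rfl⟩, fun v hv => ?_⟩,
    isConnected_restrict hV hne hends hJG hJ⟩
  rw [degree_restrict hends hJG]
  rw [vertexSet_restrict, ← hV] at hv
  exact hdeg v hv

theorem IsFactor.isEulerian {H : Graph α β} (h : H.IsFactor G {2, 4}) (hc : H.IsConnected) :
    H.IsEulerian := by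
  refine ⟨hc, fun v hv => ?_⟩
  rcases h.2 v hv with h | h
  · rw [h]; decide
  · rw [Set.mem_singleton_iff.1 h]; decide

end Graph

open Multigraph Graph in
theorem mainTheorem5 {α β : Type*} (G : Graph α β) [G.Loopless]
    (hV : G.vertexSet.Finite) (hE : G.edgeSet.Finite) :
    (G.IsTreeConnected 2 → 2 ≤ G.vertexSet.ncard →
      (∀ S : Set α, S ⊆ G.vertexSet →
        ((G.deleteVerts S).numComponents : ℝ) ≤ 2 / 7 * (S.ncard : ℝ) + 9 / 7) →
      ∃ H : Graph α β, H.IsFactor G {2, 4} ∧ H.IsConnected) ∧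
    (G.IsTough (3 + 1 / 2) → 3 ≤ G.vertexSet.ncard →
      ∃ H : Graph α β, H.IsFactor G {2, 4} ∧ H.IsConnected ∧ H.IsEulerian) := by
  rcases G.vertexSet.eq_empty_or_nonempty with h0 | ⟨r, hr⟩
  · rw [h0, Set.ncard_empty]
    exact ⟨fun _ h => by omega, fun _ h => by omega⟩
  have : Nonempty α := ⟨r⟩
  obtain ⟨ends, hends⟩ := exists_ends G
  obtain ⟨V, hV⟩ := hV.exists_finset_coe
  obtain ⟨E, hE⟩ := hE.exists_finset_coe
  have hmemV : ∀ v, v ∈ V ↔ v ∈ G.vertexSet := fun v => by rw [← hV]; rfl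
  have hmemE : ∀ e, e ∈ E ↔ e ∈ G.edgeSet := fun e => by rw [← hE]; rfl
  have hne : V.Nonempty := ⟨r, (hmemV r).2 hr⟩
  have hEV : ∀ e ∈ E, ∀ x ∈ ends e, x ∈ V := by
    rintro e he x ⟨y, hxy⟩
    exact (hmemV x).2 ((hends e ((hmemE e).1 he) x y).2 hxy).left_mem
  have hl : ∀ e ∈ E, ¬ (ends e).IsDiag := by
    intro e he hd
    induction hz : ends e with | _ x y =>
    rw [hz, Sym2.mk_isDiag_iff] at hd
    subst hd
    exact Loopless.not_isLoopAt e x ((hends e ((hmemE e).1 he) x x).2 hz)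
  have hcard : G.vertexSet.ncard = V.card := by rw [← hV, Set.ncard_coe_finset]
  have hsub : ∀ W ⊆ V, (W : Set α) ⊆ G.vertexSet := fun W hW => hV ▸ Finset.coe_subset.2 hW
  rw [hcard]
  constructor
  · rintro ⟨T, hT, hd⟩ h2 hω
    have hcon := fun i => IsConnected.connects hV hE hends (hT i).1 (hT i).2.2.connected
    obtain ⟨H, hHE, hH, hHV⟩ := exists_sparse_tight_of_connects hne hEV (Finset.filter_subset _ _)
      (Finset.filter_subset _ _) (Finset.disjoint_left.2 fun e he he' =>
        Set.disjoint_left.1 (hd 0 1 (by decide)) (Finset.mem_filter.1 he).2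
          (Finset.mem_filter.1 he').2) (hcon 0) (hcon 1)
    refine exists_factor_of_connects hV hne hE hends
      (exists_connects_deg_two_four h2 hEV hl hHE hH hHV fun W hW k hk => ?_)
    have h1 := le_numComponents_of_hasColoring hV hE hends hk
    have h2 := hω W (hsub W hW)
    rw [Set.ncard_coe_finset] at h2
    have h3 : (k : ℝ) ≤ (G.deleteVerts (W : Set α)).numComponents := by exact_mod_cast h1
    have h4 : (7 * k : ℝ) ≤ 2 * W.card + 9 := by linarith
    exact_mod_cast h4
  · intro htough h3
    obtain ⟨H, hH, hc⟩ := exists_factor_of_connects hV hne hE hends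
      (exists_connects_deg_two_four_of_tough h3 hEV hl fun W hW k hk => by
        have h1 := le_numComponents_of_hasColoring hV hE hends hk
        have h2 := htough W (hsub W hW)
        rw [Set.ncard_coe_finset] at h2
        have h3 : (k : ℝ) ≤ (G.deleteVerts (W : Set α)).numComponents := by exact_mod_cast h1
        rcases le_max_iff.1 (h3.trans h2) with h | h
        · have : k ≤ 1 := by exact_mod_cast h
          omega
        · have h4 : (7 * k : ℝ) ≤ 2 * W.card := by linarith
          have h5 : 7 * k ≤ 2 * W.card := by exact_mod_cast h4
          omega)
    exact ⟨H, hH, hc, hH.isEulerian hc⟩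

end
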